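/- **Model.** Let $W$ be an $m$-dimensional Brownian motion on a probability space, $\Delta>0$, $N\in\mathbb N$, $t_n=n\Delta$, $r\ge 0$, $\mu\in\mathbb R^d$, and let $\sigma\in\mathbb R^{d\times m}$ have linearly independent rows. The relative discounted returns of the $d$ stocks are $$R^k_{t_{n+1}}=e^{-r\Delta}\exp\Big\{\big(\mu^k-\tfrac12\textstyle\sum_j(\sigma^{kj})^2\big)\Delta+\sum_j\sigma^{kj}(W^j_{t_{n+1}}-W^j_{t_n})\Big\}-1 .$$ A strategy $\nu=(\varphi,\eta)$ consists of measurable functions of time and wealth with values in $[0,\infty)^{d+1}$ (amounts invested in the stocks and amount consumed); its wealth process satisfies $X_{t_{k+1}}=e^{r\Delta}(X_{t_k}-\eta_{t_k}+\varphi_{t_k}'R_{t_{k+1}})$, where $\varphi_{t_k},\eta_{t_k}$ are evaluated at $(t_k,X_{t_k})$. Let $\widetilde f,\widetilde\epsilon$ be nonnegative measurable functions of $(t,x)$, $x>0$ (benchmark and risk bound), and $\widetilde\psi$ a measurable real function of $(t,x,\bar\varphi,\bar\eta)$ (risk). Let $\mathcal A(t_n,x)$ be the set of strategies which, started at time $t_n$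 with wealth $X_{t_n}=x$, satisfy almost surely for all $k=n,\dots,N-1$: $X_{t_k}>0$, $0\le\eta_{t_k}\le X_{t_k}$, $0\le\varphi_{t_k}'\mathbf 1\le X_{t_k}-\eta_{t_k}$ and $\widetilde\psi(t_k,X_{t_k},\varphi_{t_k},\eta_{t_k})\le\widetilde\epsilon(t_k,X_{t_k})$, and whose losses $L_{t_k}=\widetilde f(t_k,X_{t_k})-X_{t_{k+1}}$ are integrable. For $0<\gamma<1$ the value function is, with $\sup\varnothing=-\infty$, $$V(t_n,x)=\sup_{\nu\in\mathcal A(t_n,x)}E_{t_n,x}\Big[\sum_{k=n}^{N-1}\frac{\eta_{t_k}^{1-\gamma}}{1-\gamma}+\frac{X_{t_N}^{1-\gamma}}{1-\gamma}\Big],\qquad x>0 .$$ Let $\mathcal P=\{p\in[0,1]^d: p^1+\dots+p^d\le 1\}$, $\widetilde\psi_{rel}(t_n,x,\bar\beta,\bar\zeta)=\widetilde\psi(t_n,x,(1-\bar\zeta)x\bar\beta,\bar\zeta x)$ and $\mathcal B(t_n,x,\bar\zeta)=\{\bar\beta\in\mathcal P:\widetilde\psi_{rel}(t_n,x,\bar\beta,\bar\zeta)\le\widetilde\epsilon(t_n,x)\}$.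 **Assumptions.** (a) $\mathcal A(t_0,x_0)\ne\varnothing$ for some $x_0>0$. (b) The benchmark is such that, from every $(t_n,x)$ with $x>0$, each strategy that meets all the other requirements in the definition of $\mathcal A(t_n,x)$ has integrable losses. (c) For $n<N-1$ and $x>0$: if $\mathcal B(t_n,x,1)\neq\varnothing$, then there are $\bar\zeta\in[0,1)$ arbitrarily close to $1$ with $\mathcal B(t_n,x,\bar\zeta)\ne\varnothing$. **Theorem 1.** Consider the backward recursion $$d_{t_N}=1,\qquad d_{t_n}=\sup_{0\le\bar\zeta\le 1}\Big\{\bar\zeta^{1-\gamma}+(1-\bar\zeta)^{1-\gamma}e^{r\Delta(1-\gamma)}\Big(\sup_{\bar\beta\in\mathcal B(t_n,x,\bar\zeta)}E\big[(1+\bar\beta'R_{t_{n+1}})^{1-\gamma}\big]\Big)d_{t_{n+1}}\Big\},\quad n=N-1,\dots,0,\ x>0,$$ where the values $\bar\zeta$ with $\mathcal B(t_n,x,\bar\zeta)=\varnothing$ are left out of the first supremum. (i) If the real numbers $d_{t_0},\dots,d_{t_N}$ (not depending on $x$) satisfy this recursion for every $x>0$, then $$V(t_n,x)=\frac{x^{1-\gamma}}{1-\gamma}\,d_{t_n},\qquad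 n=0,\dots,N,\ x>0 .$$ (ii) If the sets $\mathcal B(t_n,x,\bar\zeta)$, $n<N$, $\bar\zeta\in[0,1]$, do not depend on $x>0$, then such numbers $d_{t_0},\dots,d_{t_N}$ exist, and so $V$ has the form in (i). -/

import Mathlib

open MeasureTheory ProbabilityTheory
open scoped NNReal ENNReal

noncomputable section

namespace PowerDP

/-- Parameters of the Black-Scholes-Merton market with `d` stocks driven by an `m`-dimensional
Brownian motion, discretised into `N` trading periods of length `Δ`. -/
structure Market (d m : ℕ) where
  /-- interest rate -/
  r : ℝ
  r_nonneg : 0 ≤ r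
  /-- mean rates of return -/
  μ : Fin d → ℝ
  /-- volatility matrix -/
  σ : Matrix (Fin d) (Fin m) ℝ
  σ_rows : LinearIndependent ℝ σ.row
  /-- length of a trading period -/
  Δ : ℝ≥0
  Δ_pos : 0 < Δ
  /-- number of trading periods -/
  N : ℕ

/-- `W` is an `m`-dimensional standard Brownian motion: its coordinates are independent
one-dimensional standard Brownian motions. -/
structure IsBrownianVec {Ω : Type*} [MeasurableSpace Ω] {m : ℕ}
    (W : Fin m → ℝ≥0 → Ω → ℝ) (P : Measure Ω) : Prop where
  measurable : ∀ j t, Measurable (W j t)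
  brownian : ∀ j, IsBrownianReal (W j) P
  indep : iIndepFun (fun j ω t => W j t ω) P

/-- The data of the dynamic risk constraint `ψ ≤ ε` imposed at the trading times, where the first
argument `n` stands for the trading time `t_n`: the benchmark `Y_{t_n} = f n X_{t_n}`, the risk
`ψ n X_{t_n} φ_{t_n} η_{t_n}` of the position with amounts `φ` invested in the stocks and `η`
consumed, and the bound `ε n X_{t_n}`. -/
structure RiskConstraint (d : ℕ) where
  /-- benchmark as a function of time and wealth -/
  f : ℕ → ℝ → ℝ
  f_measurable : ∀ n, Measurable (f n)
  f_nonneg : ∀ n x, 0 < x → 0 ≤ f n x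
  /-- risk as a function of time, wealth, amounts invested and amount consumed -/
  ψ : ℕ → ℝ → (Fin d → ℝ) → ℝ → ℝ
  ψ_measurable : ∀ n, Measurable fun p : ℝ × (Fin d → ℝ) × ℝ => ψ n p.1 p.2.1 p.2.2
  /-- bound as a function of time and wealth -/
  ε : ℕ → ℝ → ℝ
  ε_measurable : ∀ n, Measurable (ε n)
  ε_nonneg : ∀ n x, 0 < x → 0 ≤ ε n x

/-- A Markov investment-consumption strategy: measurable functions of time and current wealth,
with values in `[0,∞)^{d+1}`. The strategy process is `(φ k X_k, η k X_k)`; it is automatically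
adapted, since the wealth is. -/
structure Strategy (d : ℕ) where
  /-- amounts invested in the stocks -/
  φ : ℕ → ℝ → Fin d → ℝ
  /-- amount consumed -/
  η : ℕ → ℝ → ℝ
  φ_measurable : ∀ n, Measurable (φ n)
  η_measurable : ∀ n, Measurable (η n)
  φ_nonneg : ∀ n x i, 0 ≤ φ n x i
  η_nonneg : ∀ n x, 0 ≤ η n x

/-- Power utility `x^{1-γ}/(1-γ)`. -/
def powerUtility (γ x : ℝ) : ℝ := x ^ (1 - γ) / (1 - γ)

/-- The unit simplex `{p ∈ [0,1]^d | p¹ + ... + p^d ≤ 1}`. -/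
def simplex (d : ℕ) : Set (Fin d → ℝ) :=
  {p | (∀ i, 0 ≤ p i ∧ p i ≤ 1) ∧ ∑ i, p i ≤ 1}

/-- Positions `(φ, η)` at wealth `x` without borrowing and with at most all wealth consumed. -/
def positions {d : ℕ} (x : ℝ) : Set ((Fin d → ℝ) × ℝ) :=
  {ν | (0 ≤ ν.2 ∧ ν.2 ≤ x) ∧ 0 ≤ ∑ i, ν.1 i ∧ ∑ i, ν.1 i ≤ x - ν.2}

/-- Positions at time `t_n` and wealth `x` which satisfy the risk constraint. -/
def riskPositions {d : ℕ} (C : RiskConstraint d) (n : ℕ) (x : ℝ) : Set ((Fin d → ℝ) × ℝ) :=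
  {ν | ν ∈ positions x ∧ C.ψ n x ν.1 ν.2 ≤ C.ε n x}

/-- The risk in terms of the investment proportions `β` and the consumption proportion `ζ`. -/
def RiskConstraint.ψrel {d : ℕ} (C : RiskConstraint d) (n : ℕ) (x : ℝ) (β : Fin d → ℝ) (ζ : ℝ) :
    ℝ :=
  C.ψ n x (((1 - ζ) * x) • β) (ζ * x)

/-- The set `𝓑(t_n, x, ζ)` of investment proportions permitted by the risk constraint. -/
def feasible {d : ℕ} (C : RiskConstraint d) (n : ℕ) (x ζ : ℝ) : Set (Fin d → ℝ) :=
  {β | β ∈ simplex d ∧ C.ψrel n x β ζ ≤ C.ε n x}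

section Model

variable {Ω : Type*} {d m : ℕ}

/-- The relative price change of stock `k` over `[t_n, t_{n+1})`. -/
def Market.priceRatio (M : Market d m) (W : Fin m → ℝ≥0 → Ω → ℝ) (n : ℕ) (k : Fin d) (ω : Ω) :
    ℝ :=
  Real.exp ((M.μ k - (∑ j, M.σ k j ^ 2) / 2) * M.Δ
    + ∑ j, M.σ k j * (W j (((n + 1 : ℕ) : ℝ≥0) * M.Δ) ω - W j ((n : ℝ≥0) * M.Δ) ω))

/-- The relative discounted return `R^k_{t_{n+1}}` of stock `k` over `[t_n, t_{n+1})`. -/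
def Market.ret (M : Market d m) (W : Fin m → ℝ≥0 → Ω → ℝ) (n : ℕ) (k : Fin d) (ω : Ω) : ℝ :=
  Real.exp (-(M.r * M.Δ)) * M.priceRatio W n k ω - 1

/-- `wealth M W ν n x k` is the wealth at time `t_k` of the strategy `ν` started at time `t_n` with
wealth `x` (and equals `x` for `k ≤ n`). -/
def wealth (M : Market d m) (W : Fin m → ℝ≥0 → Ω → ℝ) (ν : Strategy d) (n : ℕ) (x : ℝ) :
    ℕ → Ω → ℝ
  | 0, _ => x
  | k + 1, ω =>
    if n ≤ k then
      Real.exp (M.r * M.Δ) *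
        (wealth M W ν n x k ω - ν.η k (wealth M W ν n x k ω)
          + ∑ i, ν.φ k (wealth M W ν n x k ω) i * M.ret W k i ω)
    else x

/-- The position held at time `t_k` by the strategy `ν` started at time `t_n` with wealth `x`. -/
def position (M : Market d m) (W : Fin m → ℝ≥0 → Ω → ℝ) (ν : Strategy d) (n : ℕ) (x : ℝ)
    (k : ℕ) (ω : Ω) : (Fin d → ℝ) × ℝ :=
  (ν.φ k (wealth M W ν n x k ω), ν.η k (wealth M W ν n x k ω))

/-- The loss `L_{t_k} = Y_{t_k} - X_{t_{k+1}}` over the period `[t_k, t_{k+1})`. -/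
def loss (M : Market d m) (W : Fin m → ℝ≥0 → Ω → ℝ) (C : RiskConstraint d) (ν : Strategy d)
    (n : ℕ) (x : ℝ) (k : ℕ) (ω : Ω) : ℝ :=
  C.f k (wealth M W ν n x k ω) - wealth M W ν n x (k + 1) ω

variable [MeasurableSpace Ω]

/-- Admissible strategies from `(t_n, x)`: at every trading time the wealth is positive and there is
neither short-selling nor borrowing. -/
def admissible (M : Market d m) (W : Fin m → ℝ≥0 → Ω → ℝ) (P : Measure Ω) (n : ℕ) (x : ℝ) :
    Set (Strategy d) :=
  {ν | ∀ k, n ≤ k → k < M.N → ∀ᵐ ω ∂P,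
    0 < wealth M W ν n x k ω ∧ position M W ν n x k ω ∈ positions (wealth M W ν n x k ω)}

/-- Admissible strategies from `(t_n, x)` with integrable losses. -/
def lossAdmissible (M : Market d m) (W : Fin m → ℝ≥0 → Ω → ℝ) (P : Measure Ω)
    (C : RiskConstraint d) (n : ℕ) (x : ℝ) : Set (Strategy d) :=
  {ν | ν ∈ admissible M W P n x ∧ ∀ k, n ≤ k → k < M.N → Integrable (loss M W C ν n x k) P}

/-- The strategy `ν`, started from `(t_n, x)`, satisfies the risk constraint at all trading
times. -/
def RespectsRisk (M : Market d m) (W : Fin m → ℝ≥0 → Ω → ℝ) (P : Measure Ω)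
    (C : RiskConstraint d) (n : ℕ) (x : ℝ) (ν : Strategy d) : Prop :=
  ∀ k, n ≤ k → k < M.N → ∀ᵐ ω ∂P,
    position M W ν n x k ω ∈ riskPositions C k (wealth M W ν n x k ω)

/-- Admissible strategies from `(t_n, x)` with integrable losses which satisfy the risk
constraint. -/
def riskAdmissible (M : Market d m) (W : Fin m → ℝ≥0 → Ω → ℝ) (P : Measure Ω)
    (C : RiskConstraint d) (n : ℕ) (x : ℝ) : Set (Strategy d) :=
  {ν | ν ∈ lossAdmissible M W P C n x ∧ RespectsRisk M W P C n x ν}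

/-- Expected utility of consumption and terminal wealth of the strategy `ν` from `(t_n, x)`. The
utility of an admissible strategy is almost surely nonnegative, so its expectation is a Lebesgue
integral in `[0, ∞]`. -/
def expectedUtility (M : Market d m) (W : Fin m → ℝ≥0 → Ω → ℝ) (P : Measure Ω) (γ : ℝ) (n : ℕ)
    (x : ℝ) (ν : Strategy d) : ℝ≥0∞ :=
  ∫⁻ ω, ENNReal.ofReal
    (∑ k ∈ Finset.Ico n M.N, powerUtility γ (ν.η k (wealth M W ν n x k ω))
      + powerUtility γ (wealth M W ν n x M.N ω)) ∂P

/-- The value function `V(t_n, x)`, with the convention that a supremum over the empty set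
is `-∞`. -/
def valueFunction (M : Market d m) (W : Fin m → ℝ≥0 → Ω → ℝ) (P : Measure Ω)
    (C : RiskConstraint d) (γ : ℝ) (n : ℕ) (x : ℝ) : EReal :=
  ⨆ ν ∈ riskAdmissible M W P C n x, ((expectedUtility M W P γ n x ν : ℝ≥0∞) : EReal)

/-- `E[(1 + β' R_{t_{n+1}})^{1-γ}]`. -/
def returnMoment (M : Market d m) (W : Fin m → ℝ≥0 → Ω → ℝ) (P : Measure Ω) (γ : ℝ) (n : ℕ)
    (β : Fin d → ℝ) : ℝ :=
  ∫ ω, (1 + ∑ i, β i * M.ret W n i ω) ^ (1 - γ) ∂P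

/-- The right-hand side of the backward recursion at time `t_n` and wealth `x`, as a function of
the coefficient `dnext` at time `t_{n+1}`. Consumption proportions `ζ` for which no investment
proportion is permitted do not take part in the supremum. -/
def recursionRHS (M : Market d m) (W : Fin m → ℝ≥0 → Ω → ℝ) (P : Measure Ω)
    (C : RiskConstraint d) (γ : ℝ) (n : ℕ) (x dnext : ℝ) : EReal :=
  ⨆ ζ ∈ {ζ : ℝ | ζ ∈ Set.Icc (0 : ℝ) 1 ∧ (feasible C n x ζ).Nonempty},
    ((ζ ^ (1 - γ) + (1 - ζ) ^ (1 - γ) * Real.exp (M.r * M.Δ * (1 - γ))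
      * sSup (returnMoment M W P γ n '' feasible C n x ζ) * dnext : ℝ) : EReal)

/-- The numbers `c 0, ..., c N` satisfy the terminal condition and the backward recursion, the
latter at every wealth level. -/
def SolvesRecursion (M : Market d m) (W : Fin m → ℝ≥0 → Ω → ℝ) (P : Measure Ω)
    (C : RiskConstraint d) (γ : ℝ) (c : ℕ → ℝ) : Prop :=
  c M.N = 1 ∧ ∀ n < M.N, ∀ x : ℝ, 0 < x →
    ((c n : ℝ) : EReal) = recursionRHS M W P C γ n x (c (n + 1))

end Model

end PowerDP

end

/-!
The value function is found by a verification argument. By homogeneity of the power utility, a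
position at wealth `x` with consumption proportion `ζ` and investment proportions `β` contributes
`x^{1-γ}` times a number `periodValue` that depends on `(ζ, β)` only; `d_{t_k}` is the supremum of
these numbers over the permitted proportions when the coefficient of the next period is
`d_{t_{k+1}}`. The current wealth `X_k` is independent of the coming returns
(`IsBrownianVec.indepFun_wealth_ret`), so averaging over these first gives
`E[η_k^{1-γ}] + d_{k+1} E[X_{k+1}^{1-γ}] ≤ d_k E[X_k^{1-γ}]` for every admissible strategy. Summing
over the periods bounds its expected utility (`IsBrownianVec.expectedUtility_le`).

For the opposite inequality a strategy is needed whose proportions attain, in every period, a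
fraction `θ < 1` of the supremum (`IsBrownianVec.exists_le_expectedUtility`). The permitted
proportions may vary with the wealth in a merely measurable way, so they have to be chosen by
measurable selection. A selection that is Borel and correct almost everywhere for the law of `X_k`
is enough (`exists_measurable_selection`), and since that law depends on the earlier periods only,
the strategy can be built forward in time (`IsBrownianVec.exists_strategy`). Before the last period
`ζ < 1` keeps the wealth positive; full consumption is approximated by partial consumption.

When the permitted proportions do not depend on the wealth, the recursion can be solved at wealth
`1`: its right-hand side is finite because the one-period moments are bounded on the simplex, and
not `-∞` because the given admissible strategy visits some positive wealth at every trading time.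
-/

namespace PowerDP

/-! ### Measurable selection -/

/-- Analytic sets are capacitable: the image of an analytic set under a continuous map is exhausted
in measure, from inside, by the images of compact subsets. -/
lemma exists_isCompact_le_measure_image {X Z : Type*} [TopologicalSpace X] [T2Space X]
    [MeasurableSpace X] (μ : Measure X) [μ.OuterRegular] [TopologicalSpace Z] {A : Set Z}
    (hA : AnalyticSet A) {π : Z → X} (hπ : Continuous π) {a : ℝ≥0∞} (ha : a < μ (π '' A)) :
    ∃ K ⊆ A, IsCompact K ∧ a ≤ μ (π '' K) := by
  rw [AnalyticSet] at hA
  obtain rfl | ⟨g, hg, rfl⟩ := hA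
  · simp at ha
  -- `A` is the image of Baire space. Bounding one more coordinate of the sequences loses no strict
  -- lower bound on the outer measure, by continuity along increasing unions.
  have step (T : {T : Set (ℕ → ℕ) // a < μ ((π ∘ g) '' T)}) (k : ℕ) :
      ∃ j, a < μ ((π ∘ g) '' (T.1 ∩ {s | s k ≤ j})) := by
    have hT := T.2
    have hU : (π ∘ g) '' T.1 = ⋃ j : ℕ, (π ∘ g) '' (T.1 ∩ {s | s k ≤ j}) := by
      rw [← Set.image_iUnion, ← Set.inter_iUnion, Set.iUnion_eq_univ_iff.2 fun s => ⟨s k, by simp⟩,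
        Set.inter_univ]
    have hmono : Monotone fun j : ℕ => (π ∘ g) '' (T.1 ∩ {s | s k ≤ j}) := fun i j hij =>
      Set.image_mono fun s hs => ⟨hs.1, le_trans hs.2 hij⟩
    rw [hU, hmono.measure_iUnion] at hT
    exact lt_iSup_iff.1 hT
  choose j hj using step
  let T : ℕ → {T : Set (ℕ → ℕ) // a < μ ((π ∘ g) '' T)} := fun n =>
    Nat.rec ⟨Set.univ, by rwa [Set.image_comp, Set.image_univ]⟩
      (fun k S => ⟨S.1 ∩ {s | s k ≤ j S k}, hj S k⟩) n
  let b : ℕ → ℕ := fun k => j (T k) k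
  have hT (k : ℕ) : (T k).1 = {s | ∀ i < k, s i ≤ b i} := by
    induction k with
    | zero => simp [T]
    | succ k ih =>
      have : (T (k + 1)).1 = (T k).1 ∩ {s | s k ≤ b k} := rfl
      rw [this, ih]
      ext s
      simp only [Set.mem_inter_iff, Set.mem_ofPred_eq, Order.lt_add_one_iff]
      constructor
      · rintro ⟨h1, h2⟩ i hi
        rcases hi.lt_or_eq with h | rfl
        exacts [h1 i h, h2]
      · exact fun h => ⟨fun i hi => h i hi.le, h k le_rfl⟩
  let K : Set (ℕ → ℕ) := Set.pi Set.univ fun i => Set.Iic (b i)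
  have hK : IsCompact K := isCompact_univ_pi fun i => (Set.finite_Iic (b i)).isCompact
  refine ⟨g '' K, Set.image_subset_range _ _, hK.image hg, ?_⟩
  rw [← Set.image_comp, Set.measure_eq_iInf_isOpen]
  refine le_iInf₂ fun U hU => le_iInf fun hUo => ?_
  -- some cylinder around the compact box is already mapped into `U`
  suffices h : ∃ k, (T k).1 ⊆ (π ∘ g) ⁻¹' U by
    obtain ⟨k, hk⟩ := h
    exact (T k).2.le.trans (measure_mono (Set.image_subset_iff.2 hk))
  by_contra! hcon
  simp only [Set.not_subset] at hcon
  choose s hs hsU using hcon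
  obtain ⟨t, ht, φ, hφ, hlim⟩ := hK.tendsto_subseq (x := fun k i => min (s k i) (b i))
    fun k i _ => Set.mem_Iic.2 (min_le_right _ _)
  have hlim' : Filter.Tendsto (s ∘ φ) Filter.atTop (nhds t) := by
    rw [tendsto_pi_nhds] at hlim ⊢
    intro i
    refine (hlim i).congr' ?_
    filter_upwards [Filter.eventually_gt_atTop i] with k hk
    have h := hs (φ k)
    rw [hT] at h
    exact min_eq_left (h i (hk.trans_le (hφ.id_le k)))
  have hclosed : IsClosed ((π ∘ g) ⁻¹' U)ᶜ :=
    (hUo.preimage (hπ.comp hg)).isClosed_compl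
  exact hclosed.mem_of_tendsto hlim' (Filter.Eventually.of_forall fun k => hsU (φ k))
    (hU (Set.mem_image_of_mem _ ht))

/-- Over a compact set the least point of the section is a measurable selection, since its sublevel
sets are projections of compact sets (`sInf ∅ = 0` outside the projection of `K`). -/
lemma measurable_sInf_section {X : Type*} [TopologicalSpace X] [T2Space X] [MeasurableSpace X]
    [BorelSpace X] {K : Set (X × ℝ)} (hK : IsCompact K) :
    Measurable (fun x => sInf {y | (x, y) ∈ K}) ∧
      ∀ x ∈ Prod.fst '' K, (x, sInf {y | (x, y) ∈ K}) ∈ K := by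
  have hsec (x : X) : IsCompact {y | (x, y) ∈ K} := by
    have : {y | (x, y) ∈ K} = Prod.snd '' (K ∩ Prod.fst ⁻¹' {x}) := by
      ext y; simp
    rw [this]
    exact (hK.inter_right (isClosed_singleton.preimage continuous_fst)).image continuous_snd
  have hmem : ∀ x ∈ Prod.fst '' K, (x, sInf {y | (x, y) ∈ K}) ∈ K := by
    rintro x ⟨⟨x', y⟩, hy, rfl⟩
    exact (hsec x').sInf_mem ⟨y, hy⟩
  refine ⟨measurable_of_Iic fun a => ?_, hmem⟩
  have h1 : MeasurableSet (Prod.fst '' (K ∩ Prod.snd ⁻¹' Set.Iic a)) :=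
    ((hK.inter_right (isClosed_Iic.preimage continuous_snd)).image
      continuous_fst).isClosed.measurableSet
  have h2 : MeasurableSet (Prod.fst '' K) := (hK.image continuous_fst).isClosed.measurableSet
  have : (fun x => sInf {y | (x, y) ∈ K}) ⁻¹' Set.Iic a =
      Prod.fst '' (K ∩ Prod.snd ⁻¹' Set.Iic a) ∪ ((Prod.fst '' K)ᶜ ∩ {_x | 0 ≤ a}) := by
    ext x
    by_cases hx : x ∈ Prod.fst '' K
    · simp only [Set.mem_preimage, Set.mem_Iic, Set.mem_union, Set.mem_inter_iff,
        Set.mem_compl_iff, hx, not_true_eq_false, false_and, or_false]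
      constructor
      · exact fun h => ⟨_, ⟨hmem x hx, h⟩, rfl⟩
      · rintro ⟨⟨x', y⟩, ⟨hy, hya⟩, rfl⟩
        exact (csInf_le (hsec x').bddBelow hy).trans hya
    · have h0 : {y | (x, y) ∈ K} = ∅ := by
        ext y
        simp only [Set.mem_ofPred_eq, Set.mem_empty_iff_false, iff_false]
        exact fun h => hx ⟨_, h, rfl⟩
      have h3 : x ∉ Prod.fst '' (K ∩ Prod.snd ⁻¹' Set.Iic a) := fun h =>
        hx (Set.image_mono Set.inter_subset_left h)
      simp only [Set.mem_preimage, h0, Real.sInf_empty, Set.mem_Iic, Set.mem_union, h3,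
        Set.mem_inter_iff, Set.mem_compl_iff, hx, not_false_eq_true, true_and, false_or,
        Set.mem_ofPred_eq]
  rw [this]
  exact h1.union (h2.compl.inter (MeasurableSet.const _))

lemma exists_measurable_selection_real {X : Type*} [TopologicalSpace X] [PolishSpace X]
    [MeasurableSpace X] [BorelSpace X] (μ : Measure X) [IsFiniteMeasure μ] {A : Set (X × ℝ)}
    (hA : MeasurableSet A) (h : ∀ᵐ x ∂μ, ∃ y, (x, y) ∈ A) :
    ∃ f : X → ℝ, Measurable f ∧ ∀ᵐ x ∂μ, (x, f x) ∈ A := by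
  classical
  rcases eq_or_ne μ 0 with rfl | hμ
  · exact ⟨fun _ => 0, measurable_const, by simp⟩
  have hproj : μ (Prod.fst '' A) = μ Set.univ := by
    refine measure_congr (Filter.eventuallyEq_univ.2 ?_)
    filter_upwards [h] with x hx
    obtain ⟨y, hy⟩ := hx
    exact ⟨_, hy, rfl⟩
  obtain ⟨u, -, hu, hlim⟩ := exists_seq_strictMono_tendsto' (x := μ Set.univ) (y := 0)
    (Measure.measure_univ_pos.2 hμ)
  choose K hKA hK hμK using fun n => exists_isCompact_le_measure_image μ
    hA.analyticSet continuous_fst (a := u n) (hproj ▸ (hu n).2)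
  let C : ℕ → Set X := fun n => Prod.fst '' K n
  have hC (n : ℕ) : MeasurableSet (C n) :=
    ((hK n).image continuous_fst).isClosed.measurableSet
  have hCU : MeasurableSet (⋃ n, C n) := .iUnion hC
  have hfull : ∀ᵐ x ∂μ, x ∈ ⋃ n, C n := by
    refine (ae_iff_measure_eq hCU.nullMeasurableSet).2
      (le_antisymm (measure_mono (Set.subset_univ _)) ?_)
    exact le_of_tendsto' hlim fun n => (hμK n).trans (measure_mono (Set.subset_iUnion C n))
  have hex (x : X) : ∃ n, x ∈ C n ∨ x ∉ ⋃ n, C n := by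
    by_cases hx : x ∈ ⋃ n, C n
    · obtain ⟨n, hn⟩ := Set.mem_iUnion.1 hx
      exact ⟨n, .inl hn⟩
    · exact ⟨0, .inr hx⟩
  refine ⟨fun x => sInf {y | (x, y) ∈ K (Nat.find (hex x))},
    Measurable.find (p := fun n x => x ∈ C n ∨ x ∉ ⋃ n, C n)
      (fun n => (measurable_sInf_section (hK n)).1) (fun n => (hC n).union hCU.compl) hex, ?_⟩
  filter_upwards [hfull] with x hx
  exact hKA _ ((measurable_sInf_section (hK _)).2 x
    ((Nat.find_spec (hex x)).resolve_right (not_not.2 hx)))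

/-- A measurable set almost all of whose sections are nonempty contains almost all of the graph of a
measurable function. -/
theorem exists_measurable_selection {X Y : Type*} [TopologicalSpace X] [PolishSpace X]
    [MeasurableSpace X] [BorelSpace X] [MeasurableSpace Y] [StandardBorelSpace Y] [Nonempty Y]
    (μ : Measure X) [IsFiniteMeasure μ] {A : Set (X × Y)}
    (hA : MeasurableSet A) (h : ∀ᵐ x ∂μ, ∃ y, (x, y) ∈ A) :
    ∃ f : X → Y, Measurable f ∧ ∀ᵐ x ∂μ, (x, f x) ∈ A := by
  have he := measurableEmbedding_embeddingReal Y
  have hprod : MeasurableEmbedding (Prod.map id (embeddingReal Y) : X × Y → X × ℝ) :=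
    MeasurableEmbedding.id.prodMap he
  obtain ⟨f, hf, hfA⟩ := exists_measurable_selection_real μ (hprod.measurableSet_image.2 hA)
    (h.mono fun x ⟨y, hy⟩ => ⟨embeddingReal Y y, _, hy, rfl⟩)
  refine ⟨he.invFun ∘ f, he.measurable_invFun.comp hf, hfA.mono ?_⟩
  rintro x ⟨⟨x', y⟩, hy, hxy⟩
  simp only [Prod.map_apply, id_eq, Prod.mk.injEq] at hxy
  obtain ⟨rfl, hxy⟩ := hxy
  simpa [← hxy, he.leftInverse_invFun y] using hy

/-! ### Returns, wealth and their independence -/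

section Returns

variable {Ω : Type*} {d m : ℕ}

/-- The increment of the `j`-th driving Brownian motion over the `k`-th trading period. -/
def increment (M : Market d m) (W : Fin m → ℝ≥0 → Ω → ℝ) (j : Fin m) (k : ℕ) (ω : Ω) : ℝ :=
  W j (((k + 1 : ℕ) : ℝ≥0) * M.Δ) ω - W j ((k : ℝ≥0) * M.Δ) ω

lemma measurable_ret [MeasurableSpace Ω] (M : Market d m) (W : Fin m → ℝ≥0 → Ω → ℝ) (k : ℕ)
    (h : ∀ j, Measurable (increment M W j k)) (i : Fin d) : Measurable (M.ret W k i) := by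
  change Measurable fun ω => Real.exp (-(M.r * M.Δ)) *
    Real.exp ((M.μ i - (∑ j, M.σ i j ^ 2) / 2) * M.Δ + ∑ j, M.σ i j * increment M W j k ω) - 1
  have : Measurable fun ω => ∑ j, M.σ i j * increment M W j k ω :=
    Finset.measurable_fun_sum _ fun j _ => (h j).const_mul _
  fun_prop

lemma wealth_of_le (M : Market d m) (W : Fin m → ℝ≥0 → Ω → ℝ) (ν : Strategy d) (x : ℝ)
    {n k : ℕ} (hk : k ≤ n) (ω : Ω) : wealth M W ν n x k ω = x := by
  cases k with
  | zero => rfl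
  | succ k => rw [wealth, if_neg (by lia)]

lemma wealth_succ (M : Market d m) (W : Fin m → ℝ≥0 → Ω → ℝ) (ν : Strategy d) (x : ℝ)
    {n k : ℕ} (hk : n ≤ k) (ω : Ω) :
    wealth M W ν n x (k + 1) ω = Real.exp (M.r * M.Δ) *
      (wealth M W ν n x k ω - ν.η k (wealth M W ν n x k ω)
        + ∑ i, ν.φ k (wealth M W ν n x k ω) i * M.ret W k i ω) := by
  rw [wealth, if_pos hk]

/-- The wealth at time `t_k` only depends on the strategy before that time. -/
lemma wealth_congr (M : Market d m) (W : Fin m → ℝ≥0 → Ω → ℝ) {ν ν' : Strategy d} (n : ℕ) (x : ℝ)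
    {k : ℕ} (hφ : ∀ l < k, ν.φ l = ν'.φ l) (hη : ∀ l < k, ν.η l = ν'.η l) (ω : Ω) :
    wealth M W ν n x k ω = wealth M W ν' n x k ω := by
  induction k with
  | zero => rfl
  | succ k ih =>
    simp only [wealth, ih (fun l hl => hφ l (by lia)) (fun l hl => hη l (by lia)),
      hφ k (by lia), hη k (by lia)]

lemma measurable_wealth [MeasurableSpace Ω] (M : Market d m) (W : Fin m → ℝ≥0 → Ω → ℝ)
    (ν : Strategy d) (n : ℕ) (x : ℝ) (k : ℕ) (h : ∀ l < k, ∀ i, Measurable (M.ret W l i)) :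
    Measurable (wealth M W ν n x k) := by
  induction k with
  | zero => exact measurable_const
  | succ k ih =>
    have hk := ih fun l hl => h l (by lia)
    by_cases hnk : n ≤ k
    · have h1 : Measurable fun ω => ν.η k (wealth M W ν n x k ω) := (ν.η_measurable k).comp hk
      have h2 : Measurable fun ω => ∑ i, ν.φ k (wealth M W ν n x k ω) i * M.ret W k i ω :=
        Finset.measurable_fun_sum _ fun i _ =>
          ((measurable_pi_apply i).comp ((ν.φ_measurable k).comp hk)).mul (h k (by lia) i)
      rw [funext (wealth_succ M W ν x hnk)]
      exact ((hk.sub h1).add h2).const_mul _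
    · rw [funext (wealth_of_le M W ν x (by lia))]
      exact measurable_const

lemma neg_one_lt_ret (M : Market d m) (W : Fin m → ℝ≥0 → Ω → ℝ) (k : ℕ) (i : Fin d) (ω : Ω) :
    -1 < M.ret W k i ω := by
  have : 0 < Real.exp (-(M.r * M.Δ)) * M.priceRatio W k i ω :=
    mul_pos (Real.exp_pos _) (Real.exp_pos _)
  rw [Market.ret]; linarith

lemma wealth_succ_nonneg (M : Market d m) (W : Fin m → ℝ≥0 → Ω → ℝ) (ν : Strategy d)
    {n k : ℕ} (hk : n ≤ k) (x : ℝ) {ω : Ω}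
    (h : position M W ν n x k ω ∈ positions (wealth M W ν n x k ω)) :
    0 ≤ wealth M W ν n x (k + 1) ω := by
  rw [wealth_succ M W ν x hk]
  refine mul_nonneg (Real.exp_pos _).le ?_
  have h1 : ∑ i, -ν.φ k (wealth M W ν n x k ω) i ≤
      ∑ i, ν.φ k (wealth M W ν n x k ω) i * M.ret W k i ω := Finset.sum_le_sum fun i _ => by
    nlinarith [ν.φ_nonneg k (wealth M W ν n x k ω) i, neg_one_lt_ret M W k i ω]
  have h2 := h.2.2
  simp only [position] at h2
  rw [Finset.sum_neg_distrib] at h1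
  linarith

variable [MeasurableSpace Ω] {P : Measure Ω} {M : Market d m} {W : Fin m → ℝ≥0 → Ω → ℝ}

lemma IsBrownianVec.measurable_increment (hW : IsBrownianVec W P) (M : Market d m) (j : Fin m)
    (k : ℕ) : Measurable (increment M W j k) :=
  (hW.measurable j _).sub (hW.measurable j _)

lemma IsBrownianVec.measurable_ret (hW : IsBrownianVec W P) (M : Market d m) (k : ℕ) (i : Fin d) :
    Measurable (M.ret W k i) :=
  PowerDP.measurable_ret M W k (fun j => hW.measurable_increment M j k) i

lemma IsBrownianVec.measurable_wealth (hW : IsBrownianVec W P) (M : Market d m) (ν : Strategy d)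
    (n : ℕ) (x : ℝ) (k : ℕ) : Measurable (wealth M W ν n x k) :=
  PowerDP.measurable_wealth M W ν n x k fun l _ i => hW.measurable_ret M l i

lemma IsBrownianVec.iIndepFun_increment (hW : IsBrownianVec W P) (M : Market d m) :
    iIndepFun (fun p : Fin m × ℕ => increment M W p.1 p.2) P := by
  refine iIndepFun_uncurry' (X := increment M W) (hW.measurable_increment M) ?_ fun j => ?_
  · exact hW.indep.comp (fun _ (w : ℝ≥0 → ℝ) (k : ℕ) =>
      w (((k + 1 : ℕ) : ℝ≥0) * M.Δ) - w ((k : ℝ≥0) * M.Δ)) fun _ => by fun_prop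
  · have hmono : Monotone fun k : ℕ => (k : ℝ≥0) * M.Δ := fun k l hkl => by
      dsimp only; gcongr
    exact (hW.brownian j).hasIndepIncrements.nat hmono

/-- The current wealth depends on the past increments only, so it is independent of the returns
over the coming period. -/
lemma IsBrownianVec.indepFun_wealth_ret (hW : IsBrownianVec W P) (M : Market d m) (ν : Strategy d)
    (n : ℕ) (x : ℝ) (k : ℕ) :
    IndepFun (wealth M W ν n x k) (fun ω i => M.ret W k i ω) P := by
  let 𝓖 : Fin m × ℕ → MeasurableSpace Ω := fun p =>
    MeasurableSpace.comap (increment M W p.1 p.2) inferInstance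
  have hle (p : Fin m × ℕ) : 𝓖 p ≤ ‹MeasurableSpace Ω› :=
    (hW.measurable_increment M p.1 p.2).comap_le
  have hdisj : Disjoint {p : Fin m × ℕ | p.2 < k} {p | p.2 = k} := by
    rw [Set.disjoint_left]
    intro p (hp : p.2 < k) (hp' : p.2 = k)
    lia
  have hind := indep_iSup_of_disjoint hle
    ((iIndepFun_iff_iIndep _ _ _).1 (hW.iIndepFun_increment M)) hdisj
  have hincr (S : Set (Fin m × ℕ)) (j : Fin m) (l : ℕ) (hl : (j, l) ∈ S) :
      Measurable[⨆ p ∈ S, 𝓖 p] (increment M W j l) :=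
    (comap_measurable _).mono (le_iSup₂ (f := fun p (_ : p ∈ S) => 𝓖 p) (j, l) hl) le_rfl
  rw [IndepFun_iff_Indep]
  refine indep_of_indep_of_le_left (indep_of_indep_of_le_right hind ?_) ?_
  · refine Measurable.comap_le (@measurable_pi_lambda _ _ _ (_) _ _ fun i => ?_)
    exact @PowerDP.measurable_ret _ _ _ (_) M W k (fun j => hincr _ j k rfl) i
  · refine Measurable.comap_le (@PowerDP.measurable_wealth _ _ _ (_) M W ν n x k fun l hl i => ?_)
    exact @PowerDP.measurable_ret _ _ _ (_) M W l (fun j => hincr _ j l hl) i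

lemma IsBrownianVec.lintegral_wealth_ret [IsProbabilityMeasure P] (hW : IsBrownianVec W P)
    (M : Market d m) (ν : Strategy d) (n : ℕ) (x : ℝ) (k : ℕ) {G : ℝ × (Fin d → ℝ) → ℝ≥0∞}
    (hG : Measurable G) :
    ∫⁻ ω, G (wealth M W ν n x k ω, fun i => M.ret W k i ω) ∂P =
      ∫⁻ ω, ∫⁻ ω', G (wealth M W ν n x k ω, fun i => M.ret W k i ω') ∂P ∂P := by
  have hX := hW.measurable_wealth M ν n x k
  have hR : Measurable fun ω i => M.ret W k i ω := measurable_pi_lambda _ (hW.measurable_ret M k)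
  have hlaw := (indepFun_iff_map_prod_eq_prod_map_map hX.aemeasurable hR.aemeasurable).1
    (hW.indepFun_wealth_ret M ν n x k)
  rw [← lintegral_map hG (hX.prodMk hR), hlaw, lintegral_prod _ hG.aemeasurable,
    lintegral_map hG.lintegral_prod_right' hX]
  exact lintegral_congr fun ω => lintegral_map (hG.comp measurable_prodMk_left) hR

lemma IsBrownianVec.integrable_ret [IsProbabilityMeasure P] (hW : IsBrownianVec W P)
    (M : Market d m) (k : ℕ) (i : Fin d) : Integrable (M.ret W k i) P := by
  have hind : iIndepFun (fun j ω => M.σ i j * increment M W j k ω) P :=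
    ((hW.iIndepFun_increment M).precomp (g := fun j => (j, k)) fun a b h => by simpa using h).comp
      (fun j z => M.σ i j * z) fun j => by fun_prop
  have hexp := hind.integrable_exp_mul_sum (t := 1) (s := Finset.univ)
    (fun j => (hW.measurable_increment M j k).const_mul _) fun j _ => by
      have h := ((hW.brownian j).hasLaw_sub (((k + 1 : ℕ) : ℝ≥0) * M.Δ) ((k : ℝ≥0) * M.Δ))
      have hint : Integrable (fun z => Real.exp (M.σ i j * z))
          (P.map (W j (((k + 1 : ℕ) : ℝ≥0) * M.Δ) - W j ((k : ℝ≥0) * M.Δ))) := by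
        rw [h.map_eq]
        exact integrable_exp_mul_gaussianReal _
      simp only [one_mul]
      exact hint.comp_aemeasurable h.aemeasurable
  have : M.ret W k i = fun ω => Real.exp (-(M.r * M.Δ)) *
      (Real.exp ((M.μ i - (∑ j, M.σ i j ^ 2) / 2) * M.Δ) *
        Real.exp (1 * (∑ j, fun ω => M.σ i j * increment M W j k ω) ω)) - 1 := by
    ext ω
    rw [← Real.exp_add, one_mul, Finset.sum_apply]
    rfl
  rw [this]
  exact ((hexp.const_mul _).const_mul _).sub (integrable_const _)

end Returns

/-! ### One-period moments -/

section Moments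

variable {Ω : Type*} {d m : ℕ}

lemma one_add_sum_ret_pos (M : Market d m) (W : Fin m → ℝ≥0 → Ω → ℝ) (k : ℕ)
    {β : Fin d → ℝ} (hβ : β ∈ simplex d) (ω : Ω) : 0 < 1 + ∑ i, β i * M.ret W k i ω := by
  have hle (i : Fin d) : -β i ≤ β i * M.ret W k i ω := by
    nlinarith [(hβ.1 i).1, neg_one_lt_ret M W k i ω]
  by_cases h0 : ∀ i, β i = 0
  · simp [h0]
  · push Not at h0
    obtain ⟨i, hi⟩ := h0
    have hlt : ∑ i, -β i < ∑ i, β i * M.ret W k i ω :=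
      Finset.sum_lt_sum (fun i _ => hle i) ⟨i, Finset.mem_univ i, by
        nlinarith [(hβ.1 i).1.lt_of_ne' hi, neg_one_lt_ret M W k i ω]⟩
    rw [Finset.sum_neg_distrib] at hlt
    linarith [hβ.2]

lemma sum_ret_le (M : Market d m) (W : Fin m → ℝ≥0 → Ω → ℝ) (k : ℕ) {β : Fin d → ℝ}
    (hβ : β ∈ simplex d) (ω : Ω) : ∑ i, β i * M.ret W k i ω ≤ ∑ i, |M.ret W k i ω| := by
  refine Finset.sum_le_sum fun i _ => ?_
  calc β i * M.ret W k i ω ≤ β i * |M.ret W k i ω| :=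
        mul_le_mul_of_nonneg_left (le_abs_self _) (hβ.1 i).1
    _ ≤ |M.ret W k i ω| := mul_le_of_le_one_left (abs_nonneg _) (hβ.1 i).2

/-- The next-period wealth of a position given by proportions is the current wealth times a factor
that does not depend on it. -/
lemma next_wealth_eq (M : Market d m) (W : Fin m → ℝ≥0 → Ω → ℝ) (k : ℕ) (x ζ : ℝ)
    (β : Fin d → ℝ) (ω : Ω) :
    Real.exp (M.r * M.Δ) * (x - ζ * x + ∑ i, (((1 - ζ) * x) • β) i * M.ret W k i ω) =
      Real.exp (M.r * M.Δ) * (x * ((1 - ζ) * (1 + ∑ i, β i * M.ret W k i ω))) := by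
  simp only [Pi.smul_apply, smul_eq_mul, mul_assoc, ← Finset.mul_sum]
  ring

lemma wealth_succ_pos (M : Market d m) (W : Fin m → ℝ≥0 → Ω → ℝ) (ν : Strategy d)
    {n k : ℕ} (hk : n ≤ k) (x : ℝ) {ω : Ω} {ζ : ℝ}
    {β : Fin d → ℝ} (hpos : 0 < wealth M W ν n x k ω) (hζ : ζ < 1) (hβ : β ∈ simplex d)
    (hφ : ν.φ k (wealth M W ν n x k ω) = ((1 - ζ) * wealth M W ν n x k ω) • β)
    (hη : ν.η k (wealth M W ν n x k ω) = ζ * wealth M W ν n x k ω) :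
    0 < wealth M W ν n x (k + 1) ω := by
  rw [wealth_succ M W ν x hk, hφ, hη, next_wealth_eq]
  exact mul_pos (Real.exp_pos _) (mul_pos hpos
    (mul_pos (by linarith) (one_add_sum_ret_pos M W k hβ ω)))

variable [MeasurableSpace Ω] {P : Measure Ω} [IsProbabilityMeasure P] {M : Market d m}
  {W : Fin m → ℝ≥0 → Ω → ℝ} {γ : ℝ}

lemma rpow_one_sub_le_one_add (hγ0 : 0 < γ) (hγ1 : γ < 1) {y : ℝ} (hy : 0 ≤ y) :
    y ^ (1 - γ) ≤ 1 + y := by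
  rcases le_total y 1 with h | h
  · linarith [Real.rpow_le_one hy h (by linarith : 0 ≤ 1 - γ)]
  · have := Real.rpow_le_rpow_of_exponent_le h (by linarith : 1 - γ ≤ 1)
    rw [Real.rpow_one] at this
    linarith

lemma IsBrownianVec.integrable_returnMoment (hW : IsBrownianVec W P) (M : Market d m)
    (hγ0 : 0 < γ) (hγ1 : γ < 1) (k : ℕ) {β : Fin d → ℝ} (hβ : β ∈ simplex d) :
    Integrable (fun ω => (1 + ∑ i, β i * M.ret W k i ω) ^ (1 - γ)) P := by
  have hmeas : Measurable fun ω => ∑ i, β i * M.ret W k i ω :=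
    Finset.measurable_fun_sum _ fun i _ => (hW.measurable_ret M k i).const_mul _
  have hint : Integrable (fun ω => 1 + (1 + ∑ i, β i * M.ret W k i ω)) P :=
    (integrable_const _).add ((integrable_const _).add
      (integrable_finsetSum _ fun i _ => (hW.integrable_ret M k i).const_mul _))
  refine hint.mono' ((hmeas.const_add 1).pow_const _).aestronglyMeasurable (ae_of_all _ fun ω => ?_)
  have hpos := one_add_sum_ret_pos M W k hβ ω
  rw [Real.norm_of_nonneg (Real.rpow_nonneg hpos.le _)]
  exact rpow_one_sub_le_one_add hγ0 hγ1 hpos.le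

lemma IsBrownianVec.returnMoment_pos (hW : IsBrownianVec W P) (M : Market d m)
    (hγ0 : 0 < γ) (hγ1 : γ < 1) (k : ℕ) {β : Fin d → ℝ} (hβ : β ∈ simplex d) :
    0 < returnMoment M W P γ k β := by
  have hpos (ω : Ω) : 0 < (1 + ∑ i, β i * M.ret W k i ω) ^ (1 - γ) :=
    Real.rpow_pos_of_pos (one_add_sum_ret_pos M W k hβ ω) _
  rw [returnMoment, integral_pos_iff_support_of_nonneg (fun ω => (hpos ω).le)
    (hW.integrable_returnMoment M hγ0 hγ1 k hβ), 
    Set.eq_univ_of_forall fun ω => Function.mem_support.2 (hpos ω).ne']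
  simp

lemma IsBrownianVec.returnMoment_le (hW : IsBrownianVec W P) (M : Market d m)
    (hγ0 : 0 < γ) (hγ1 : γ < 1) (k : ℕ) {β : Fin d → ℝ} (hβ : β ∈ simplex d) :
    returnMoment M W P γ k β ≤ ∫ ω, (1 + (1 + ∑ i, |M.ret W k i ω|)) ∂P := by
  refine integral_mono (hW.integrable_returnMoment M hγ0 hγ1 k hβ)
    ((integrable_const _).add ((integrable_const _).add
      (integrable_finsetSum _ fun i _ => (hW.integrable_ret M k i).abs))) fun ω => ?_
  have h := rpow_one_sub_le_one_add hγ0 hγ1 (one_add_sum_ret_pos M W k hβ ω).le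
  have h' := sum_ret_le M W k hβ ω
  dsimp only
  linarith

lemma IsBrownianVec.bddAbove_returnMoment (hW : IsBrownianVec W P) (M : Market d m)
    (hγ0 : 0 < γ) (hγ1 : γ < 1) (k : ℕ) {S : Set (Fin d → ℝ)} (hS : S ⊆ simplex d) :
    BddAbove (returnMoment M W P γ k '' S) :=
  ⟨_, by rintro _ ⟨β, hβ, rfl⟩; exact hW.returnMoment_le M hγ0 hγ1 k (hS hβ)⟩

lemma IsBrownianVec.measurable_returnMoment (hW : IsBrownianVec W P) (M : Market d m)
    (γ : ℝ) (k : ℕ) : Measurable (returnMoment M W P γ k) := by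
  have hterm (i : Fin d) : Measurable fun p : (Fin d → ℝ) × Ω => p.1 i * M.ret W k i p.2 :=
    ((measurable_pi_apply i).comp measurable_fst).mul
      ((hW.measurable_ret M k i).comp measurable_snd)
  have hsum : Measurable fun p : (Fin d → ℝ) × Ω => ∑ i, p.1 i * M.ret W k i p.2 :=
    Finset.measurable_fun_sum _ fun i _ => hterm i
  have hpow : Measurable fun p : (Fin d → ℝ) × Ω =>
      (1 + ∑ i, p.1 i * M.ret W k i p.2) ^ (1 - γ) := (hsum.const_add 1).pow_const _
  have hint := hpow.stronglyMeasurable.integral_prod_right' (ν := P)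
  exact hint.measurable

lemma IsBrownianVec.lintegral_next_wealth (hW : IsBrownianVec W P) (M : Market d m)
    (hγ0 : 0 < γ) (hγ1 : γ < 1) (k : ℕ) {x ζ : ℝ} {β : Fin d → ℝ} (hx : 0 ≤ x) (hζ : ζ ≤ 1)
    (hβ : β ∈ simplex d) :
    ∫⁻ ω, ENNReal.ofReal ((Real.exp (M.r * M.Δ) *
        (x - ζ * x + ∑ i, (((1 - ζ) * x) • β) i * M.ret W k i ω)) ^ (1 - γ)) ∂P =
      ENNReal.ofReal (x ^ (1 - γ) *
        ((1 - ζ) ^ (1 - γ) * Real.exp (M.r * M.Δ * (1 - γ)) * returnMoment M W P γ k β)) := by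
  have hζ' : 0 ≤ 1 - ζ := by linarith
  have hfac (ω : Ω) : (Real.exp (M.r * M.Δ) *
        (x - ζ * x + ∑ i, (((1 - ζ) * x) • β) i * M.ret W k i ω)) ^ (1 - γ) =
      x ^ (1 - γ) * ((1 - ζ) ^ (1 - γ) * Real.exp (M.r * M.Δ * (1 - γ))) *
        (1 + ∑ i, β i * M.ret W k i ω) ^ (1 - γ) := by
    have hpos := one_add_sum_ret_pos M W k hβ ω
    rw [next_wealth_eq, Real.mul_rpow (Real.exp_pos _).le (by positivity),
      Real.mul_rpow hx (by positivity), Real.mul_rpow hζ' hpos.le, Real.exp_mul (M.r * M.Δ) (1 - γ)]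
    ring
  simp_rw [hfac]
  rw [← ofReal_integral_eq_lintegral_ofReal
    ((hW.integrable_returnMoment M hγ0 hγ1 k hβ).const_mul _)
    (ae_of_all _ fun ω => mul_nonneg (by positivity)
      (Real.rpow_nonneg (one_add_sum_ret_pos M W k hβ ω).le _)),
    integral_const_mul, ← returnMoment]
  ring_nf

end Moments

/-! ### Positions in terms of proportions -/

/-- Every permitted position comes from permitted proportions. If all wealth is consumed, nothing is
invested and `β = 0` serves. -/
lemma exists_proportions {d : ℕ} {C : RiskConstraint d} {n : ℕ} {x : ℝ} (hx : 0 < x)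
    {φ : Fin d → ℝ} {η : ℝ} (hφ : ∀ i, 0 ≤ φ i) (h : (φ, η) ∈ riskPositions C n x) :
    ∃ ζ ∈ Set.Icc (0 : ℝ) 1, ∃ β ∈ feasible C n x ζ, φ = ((1 - ζ) * x) • β ∧ η = ζ * x := by
  obtain ⟨⟨⟨h1, h2⟩, -, h4⟩, h5⟩ := h
  simp only at h1 h2 h4 h5
  have hη : η = η / x * x := by field_simp
  refine ⟨η / x, ⟨by positivity, (div_le_one hx).2 h2⟩, ?_⟩
  have hc : (1 - η / x) * x = x - η := by field_simp
  have key : ∃ β ∈ simplex d, φ = ((1 - η / x) * x) • β := by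
    rw [hc]
    rcases h2.lt_or_eq with hlt | rfl
    · have hpos : 0 < x - η := by linarith
      have hsum : ∑ i, (x - η)⁻¹ * φ i ≤ 1 := by
        rw [← Finset.mul_sum, inv_mul_le_iff₀ hpos]; linarith
      have hnn (i : Fin d) : 0 ≤ (x - η)⁻¹ * φ i := mul_nonneg (inv_pos.2 hpos).le (hφ i)
      refine ⟨(x - η)⁻¹ • φ, ⟨fun i => ⟨hnn i, ?_⟩, hsum⟩, ?_⟩
      · exact (Finset.single_le_sum (fun i _ => hnn i) (Finset.mem_univ i)).trans hsum
      · rw [smul_smul, mul_inv_cancel₀ hpos.ne', one_smul]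
    · refine ⟨0, ⟨fun i => by simp, by simp⟩, ?_⟩
      ext i
      have := Finset.single_le_sum (fun i _ => hφ i) (Finset.mem_univ i)
      simp only [smul_zero, Pi.zero_apply]
      linarith [hφ i]
  obtain ⟨β, hβ, hφβ⟩ := key
  refine ⟨β, ⟨hβ, ?_⟩, hφβ, hη⟩
  rw [RiskConstraint.ψrel, ← hφβ, ← hη]
  exact h5

lemma mem_riskPositions {d : ℕ} {C : RiskConstraint d} {n : ℕ} {x ζ : ℝ} {β : Fin d → ℝ}
    (hx : 0 ≤ x) (hζ : ζ ∈ Set.Icc (0 : ℝ) 1) (hβ : β ∈ feasible C n x ζ) :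
    (((1 - ζ) * x) • β, ζ * x) ∈ riskPositions C n x := by
  have h0 : 0 ≤ (1 - ζ) * x := mul_nonneg (by linarith [hζ.2]) hx
  refine ⟨⟨⟨mul_nonneg hζ.1 hx, mul_le_of_le_one_left hx hζ.2⟩, ?_, ?_⟩, hβ.2⟩
  · exact Finset.sum_nonneg fun i _ => mul_nonneg h0 (hβ.1.1 i).1
  · simp only [Pi.smul_apply, smul_eq_mul, ← Finset.mul_sum]
    nlinarith [hβ.1.2]

/-! ### Expected utility along a strategy -/

section Dynamic

variable {Ω : Type*} {d m : ℕ} [MeasurableSpace Ω]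

/-- The moment `E[X_k^{1-γ}]` of the wealth at time `t_k`. -/
noncomputable def wealthMoment (M : Market d m) (W : Fin m → ℝ≥0 → Ω → ℝ) (P : Measure Ω) (γ : ℝ)
    (ν : Strategy d) (n : ℕ) (x : ℝ) (k : ℕ) : ℝ≥0∞ :=
  ∫⁻ ω, ENNReal.ofReal (wealth M W ν n x k ω ^ (1 - γ)) ∂P

/-- The moment `E[η_k^{1-γ}]` of the amount consumed at time `t_k`. -/
noncomputable def consumptionMoment (M : Market d m) (W : Fin m → ℝ≥0 → Ω → ℝ) (P : Measure Ω)
    (γ : ℝ) (ν : Strategy d) (n : ℕ) (x : ℝ) (k : ℕ) : ℝ≥0∞ :=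
  ∫⁻ ω, ENNReal.ofReal (ν.η k (wealth M W ν n x k ω) ^ (1 - γ)) ∂P

variable {P : Measure Ω} {M : Market d m} {W : Fin m → ℝ≥0 → Ω → ℝ} {C : RiskConstraint d} {γ : ℝ}

lemma IsBrownianVec.measurable_consumption (hW : IsBrownianVec W P) (ν : Strategy d) (n : ℕ)
    (x : ℝ) (k : ℕ) : Measurable fun ω => ν.η k (wealth M W ν n x k ω) :=
  (ν.η_measurable k).comp (hW.measurable_wealth M ν n x k)

lemma IsBrownianVec.ofReal_mul_wealthMoment (hW : IsBrownianVec W P) {a : ℝ} (ha : 0 ≤ a)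
    (ν : Strategy d) (n : ℕ) (x : ℝ) (k : ℕ) : ENNReal.ofReal a * wealthMoment M W P γ ν n x k =
      ∫⁻ ω, ENNReal.ofReal (a * wealth M W ν n x k ω ^ (1 - γ)) ∂P := by
  rw [wealthMoment, ← lintegral_const_mul _
    ((hW.measurable_wealth M ν n x k).pow_const _).ennreal_ofReal]
  simp only [ENNReal.ofReal_mul ha]

lemma wealth_terminal_nonneg {n : ℕ} (hn : n ≤ M.N) {x : ℝ} (hx : 0 < x) {ν : Strategy d}
    (hν : ν ∈ admissible M W P n x) : ∀ᵐ ω ∂P, 0 ≤ wealth M W ν n x M.N ω := by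
  rcases hn.lt_or_eq with hlt | heq
  · obtain ⟨k, hk⟩ : ∃ k, M.N = k + 1 := ⟨M.N - 1, by lia⟩
    rw [hk]
    exact (hν k (by lia) (by lia)).mono fun ω hω => wealth_succ_nonneg M W ν (by lia) x hω.2
  · exact ae_of_all _ fun ω => (wealth_of_le M W ν x heq.ge ω).symm ▸ hx.le

lemma IsBrownianVec.expectedUtility_eq (hW : IsBrownianVec W P) (hγ1 : γ < 1) (ν : Strategy d)
    (n : ℕ) (x : ℝ)
    (h : ∀ᵐ ω ∂P, 0 ≤ wealth M W ν n x M.N ω) :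
    expectedUtility M W P γ n x ν = ENNReal.ofReal (1 - γ)⁻¹ *
      (∑ k ∈ Finset.Ico n M.N, consumptionMoment M W P γ ν n x k +
        wealthMoment M W P γ ν n x M.N) := by
  have hγ : 0 ≤ (1 - γ)⁻¹ := inv_nonneg.2 (by linarith)
  have hmeas (k : ℕ) : Measurable fun ω =>
      ENNReal.ofReal (ν.η k (wealth M W ν n x k ω) ^ (1 - γ)) :=
    ((hW.measurable_consumption ν n x k).pow_const _).ennreal_ofReal
  have hsum : Measurable fun ω => ∑ k ∈ Finset.Ico n M.N,
      ENNReal.ofReal (ν.η k (wealth M W ν n x k ω) ^ (1 - γ)) :=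
    Finset.measurable_fun_sum _ fun k _ => hmeas k
  have hX := ((hW.measurable_wealth M ν n x M.N).pow_const (1 - γ)).ennreal_ofReal
  simp only [consumptionMoment, wealthMoment]
  rw [← lintegral_finsetSum _ fun k _ => hmeas k, ← lintegral_add_left hsum,
    ← lintegral_const_mul _ (by exact hsum.add hX), expectedUtility]
  refine lintegral_congr_ae (h.mono fun ω hω => ?_)
  have hη (k : ℕ) : 0 ≤ ν.η k (wealth M W ν n x k ω) ^ (1 - γ) :=
    Real.rpow_nonneg (ν.η_nonneg _ _) _
  simp only [powerUtility, div_eq_inv_mul, ← Finset.mul_sum, ← mul_add]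
  rw [ENNReal.ofReal_mul hγ, ENNReal.ofReal_add (Finset.sum_nonneg fun k _ => hη k)
    (Real.rpow_nonneg hω _), ENNReal.ofReal_sum_of_nonneg fun k _ => hη k]

/-! ### The one-period problem -/

/-- The quantity maximised in the backward recursion at time `t_k`, for given consumption proportion
`ζ`, investment proportions `β` and coefficient `c'` at time `t_{k+1}`. -/
noncomputable def periodValue (M : Market d m) (W : Fin m → ℝ≥0 → Ω → ℝ) (P : Measure Ω)
    (γ : ℝ) (k : ℕ) (c' ζ : ℝ) (β : Fin d → ℝ) : ℝ :=
  ζ ^ (1 - γ) + (1 - ζ) ^ (1 - γ) * Real.exp (M.r * M.Δ * (1 - γ)) * returnMoment M W P γ k β * c'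

lemma exists_feasible_of_coe_eq {k : ℕ} {x c₀ c' : ℝ}
    (hc : (c₀ : EReal) = recursionRHS M W P C γ k x c') :
    ∃ ζ ∈ Set.Icc (0 : ℝ) 1, (feasible C k x ζ).Nonempty := by
  by_contra! hcon
  have : recursionRHS M W P C γ k x c' = ⊥ := by
    rw [recursionRHS, eq_bot_iff]
    exact iSup₂_le fun ζ hζ => absurd hζ.2 (Set.not_nonempty_iff_eq_empty.2 (hcon ζ hζ.1))
  exact EReal.coe_ne_bot _ (hc.trans this)

variable [IsProbabilityMeasure P]

/-- One period moments are bounded uniformly over the simplex, so the recursion stays finite. -/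
lemma IsBrownianVec.recursionRHS_ne_top (hW : IsBrownianVec W P) (hγ0 : 0 < γ) (hγ1 : γ < 1)
    (k : ℕ) (x : ℝ) {c' : ℝ} (hc' : 0 ≤ c') : recursionRHS M W P C γ k x c' ≠ ⊤ := by
  let B := ∫ ω, (1 + (1 + ∑ i, |M.ret W k i ω|)) ∂P
  refine ne_top_of_le_ne_top (EReal.coe_ne_top
    (1 + 1 * Real.exp (M.r * M.Δ * (1 - γ)) * B * c')) ?_
  refine iSup₂_le fun ζ hζ => EReal.coe_le_coe_iff.2 ?_
  have hγ : 0 ≤ 1 - γ := by linarith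
  have h1 : ζ ^ (1 - γ) ≤ 1 := Real.rpow_le_one hζ.1.1 hζ.1.2 hγ
  have h2 : (1 - ζ) ^ (1 - γ) ≤ 1 :=
    Real.rpow_le_one (by linarith [hζ.1.2]) (by linarith [hζ.1.1]) hγ
  have h3 : 0 ≤ (1 - ζ) ^ (1 - γ) := Real.rpow_nonneg (by linarith [hζ.1.2]) _
  have h4 : sSup (returnMoment M W P γ k '' feasible C k x ζ) ≤ B :=
    csSup_le (hζ.2.image _) (by
      rintro _ ⟨β, hβ, rfl⟩; exact hW.returnMoment_le M hγ0 hγ1 k hβ.1)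
  have h6 : 0 ≤ sSup (returnMoment M W P γ k '' feasible C k x ζ) := Real.sSup_nonneg (by
    rintro _ ⟨β, hβ, rfl⟩; exact (hW.returnMoment_pos M hγ0 hγ1 k hβ.1).le)
  have h5 : 0 ≤ B := by
    obtain ⟨β, hβ⟩ := hζ.2
    exact (hW.returnMoment_pos M hγ0 hγ1 k hβ.1).le.trans (hW.returnMoment_le M hγ0 hγ1 k hβ.1)
  gcongr

lemma IsBrownianVec.periodValue_le (hW : IsBrownianVec W P) (hγ0 : 0 < γ) (hγ1 : γ < 1)
    {k : ℕ} {x c₀ c' ζ : ℝ} {β : Fin d → ℝ} (hc' : 0 ≤ c')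
    (hc : (c₀ : EReal) = recursionRHS M W P C γ k x c') (hζ : ζ ∈ Set.Icc (0 : ℝ) 1)
    (hβ : β ∈ feasible C k x ζ) : periodValue M W P γ k c' ζ β ≤ c₀ := by
  rw [← EReal.coe_le_coe_iff, hc]
  refine le_trans ?_ (le_iSup₂ (α := EReal) ζ ⟨hζ, β, hβ⟩)
  rw [EReal.coe_le_coe_iff, periodValue]
  have h1 : 0 ≤ (1 - ζ) ^ (1 - γ) := Real.rpow_nonneg (by linarith [hζ.2]) _
  have h2 : returnMoment M W P γ k β ≤ sSup (returnMoment M W P γ k '' feasible C k x ζ) :=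
    le_csSup (hW.bddAbove_returnMoment M hγ0 hγ1 k fun β hβ => hβ.1) ⟨β, hβ, rfl⟩
  gcongr

lemma IsBrownianVec.periodValue_pos (hW : IsBrownianVec W P) (hγ0 : 0 < γ) (hγ1 : γ < 1)
    {k : ℕ} {c' ζ : ℝ} {β : Fin d → ℝ} (hc' : 0 < c') (hζ : ζ ∈ Set.Icc (0 : ℝ) 1)
    (hβ : β ∈ simplex d) : 0 < periodValue M W P γ k c' ζ β := by
  have h1 := hW.returnMoment_pos M hγ0 hγ1 k hβ
  have h0 : 0 ≤ ζ ^ (1 - γ) := Real.rpow_nonneg hζ.1 _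
  rw [periodValue]
  rcases hζ.2.lt_or_eq with h | rfl
  · have : 0 < (1 - ζ) ^ (1 - γ) := Real.rpow_pos_of_pos (by linarith) _
    positivity
  · simp [Real.zero_rpow (by linarith : 1 - γ ≠ 0)]

lemma IsBrownianVec.pos_of_coe_eq (hW : IsBrownianVec W P) (hγ0 : 0 < γ) (hγ1 : γ < 1)
    {k : ℕ} {x c₀ c' : ℝ} (hc' : 0 < c') (hc : (c₀ : EReal) = recursionRHS M W P C γ k x c') :
    0 < c₀ := by
  obtain ⟨ζ, hζ, β, hβ⟩ := exists_feasible_of_coe_eq hc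
  exact (hW.periodValue_pos hγ0 hγ1 hc' hζ hβ.1).trans_le
    (hW.periodValue_le hγ0 hγ1 hc'.le hc hζ hβ)

/-- Proportions with nearly optimal value exist, and if `p` holds (which is applied to the statement
that further periods follow) they leave some wealth unconsumed. -/
lemma IsBrownianVec.exists_periodValue_gt (hW : IsBrownianVec W P) (hγ0 : 0 < γ) (hγ1 : γ < 1)
    {k : ℕ} {x c₀ c' b : ℝ} (hc' : 0 < c') (hc : (c₀ : EReal) = recursionRHS M W P C γ k x c')
    (hb : b < c₀) {p : Prop} (hfull : p → (feasible C k x 1).Nonempty →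
      (1 : ℝ) ∈ closure {ζ : ℝ | ζ ∈ Set.Ico (0 : ℝ) 1 ∧ (feasible C k x ζ).Nonempty}) :
    ∃ ζ ∈ Set.Icc (0 : ℝ) 1, ∃ β ∈ feasible C k x ζ, (p → ζ < 1) ∧
      b ≤ periodValue M W P γ k c' ζ β := by
  have hγ : 0 < 1 - γ := by linarith
  rw [← EReal.coe_lt_coe_iff, hc, recursionRHS] at hb
  obtain ⟨ζ, hζ⟩ := lt_iSup_iff.1 hb
  obtain ⟨⟨hζI, hne⟩, hlt⟩ := lt_iSup_iff.1 hζ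
  rw [EReal.coe_lt_coe_iff] at hlt
  rcases hζI.2.lt_or_eq with hζ1 | rfl
  · have hA : 0 < (1 - ζ) ^ (1 - γ) * Real.exp (M.r * M.Δ * (1 - γ)) :=
      mul_pos (Real.rpow_pos_of_pos (by linarith) _) (Real.exp_pos _)
    set A := (1 - ζ) ^ (1 - γ) * Real.exp (M.r * M.Δ * (1 - γ))
    have hAc : 0 < A * c' := mul_pos hA hc'
    have hlt' : (b - ζ ^ (1 - γ)) / (A * c') <
        sSup (returnMoment M W P γ k '' feasible C k x ζ) := by
      rw [div_lt_iff₀ hAc]; linarith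
    obtain ⟨_, ⟨β, hβ, rfl⟩, hβlt⟩ := exists_lt_of_lt_csSup (hne.image _) hlt'
    refine ⟨ζ, hζI, β, hβ, fun _ => hζ1, ?_⟩
    rw [div_lt_iff₀ hAc] at hβlt
    rw [periodValue]
    change b ≤ ζ ^ (1 - γ) + A * _ * c'
    linarith
  · simp only [Real.one_rpow, sub_self, Real.zero_rpow hγ.ne', zero_mul, add_zero] at hlt
    by_cases hp : p
    · -- consuming everything is not allowed, but consuming almost everything is nearly as good
      have hcl := hfull hp hne
      have hcont : ContinuousAt (fun ζ : ℝ => ζ ^ (1 - γ)) 1 :=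
        Real.continuousAt_rpow_const _ _ (.inr hγ.le)
      have hev : ∀ᶠ ζ : ℝ in nhds 1, b < ζ ^ (1 - γ) :=
        hcont.eventually (lt_mem_nhds (by simpa using hlt))
      obtain ⟨ζ, ⟨hζ, β, hβ⟩, hζb⟩ := ((mem_closure_iff_frequently.1 hcl).and_eventually hev).exists
      refine ⟨ζ, ⟨hζ.1, hζ.2.le⟩, β, hβ, fun _ => hζ.2, ?_⟩
      have h1 : 0 ≤ (1 - ζ) ^ (1 - γ) := Real.rpow_nonneg (by linarith [hζ.2]) _
      have h2 := (hW.returnMoment_pos M hγ0 hγ1 k hβ.1).le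
      have : 0 ≤ (1 - ζ) ^ (1 - γ) * Real.exp (M.r * M.Δ * (1 - γ)) *
        returnMoment M W P γ k β * c' := by positivity
      rw [periodValue]; linarith
    · obtain ⟨β, hβ⟩ := hne
      refine ⟨1, hζI, β, hβ, fun h => absurd h hp, ?_⟩
      simp only [periodValue, Real.one_rpow, sub_self, Real.zero_rpow hγ.ne', zero_mul, add_zero]
      exact hlt.le

lemma IsBrownianVec.pos_of_solvesRecursion (hW : IsBrownianVec W P) (hγ0 : 0 < γ) (hγ1 : γ < 1)
    {c : ℕ → ℝ} (hc : SolvesRecursion M W P C γ c) {k : ℕ} (hk : k ≤ M.N) : 0 < c k := by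
  induction hk using Nat.decreasingInduction with
  | self => rw [hc.1]; exact one_pos
  | of_succ k hk ih => exact hW.pos_of_coe_eq hγ0 hγ1 ih (hc.2 k hk 1 one_pos)

/-- Homogeneity: utility of consumption plus expected continuation utility is the value of the
proportions times `x^{1-γ}`. -/
lemma IsBrownianVec.utility_add_next_eq (hW : IsBrownianVec W P) (hγ0 : 0 < γ) (hγ1 : γ < 1)
    (k : ℕ) {x ζ c' : ℝ} {β : Fin d → ℝ} (hc' : 0 ≤ c') (hx : 0 ≤ x) (hζ : ζ ∈ Set.Icc (0 : ℝ) 1)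
    (hβ : β ∈ simplex d) :
    ENNReal.ofReal ((ζ * x) ^ (1 - γ)) + ENNReal.ofReal c' *
      ∫⁻ ω, ENNReal.ofReal ((Real.exp (M.r * M.Δ) *
        (x - ζ * x + ∑ i, (((1 - ζ) * x) • β) i * M.ret W k i ω)) ^ (1 - γ)) ∂P =
      ENNReal.ofReal (periodValue M W P γ k c' ζ β * x ^ (1 - γ)) := by
  have h1 : 0 ≤ (1 - ζ) ^ (1 - γ) := Real.rpow_nonneg (by linarith [hζ.2]) _
  have h2 := (hW.returnMoment_pos M hγ0 hγ1 k hβ).le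
  have h3 : 0 ≤ x ^ (1 - γ) := Real.rpow_nonneg hx _
  rw [hW.lintegral_next_wealth M hγ0 hγ1 k hx hζ.2 hβ, ← ENNReal.ofReal_mul hc',
    ← ENNReal.ofReal_add (Real.rpow_nonneg (mul_nonneg hζ.1 hx) _) (by positivity),
    Real.mul_rpow hζ.1 hx, periodValue]
  ring_nf

lemma wealthMoment_self (ν : Strategy d) (n : ℕ) (x : ℝ) :
    wealthMoment M W P γ ν n x n = ENNReal.ofReal (x ^ (1 - γ)) := by
  simp [wealthMoment, wealth_of_le M W ν x le_rfl]

/-- The Markov property over one period: given the current wealth, the expected utility of the next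
wealth is obtained by averaging over the returns. -/
lemma IsBrownianVec.consumptionMoment_add (hW : IsBrownianVec W P) (ν : Strategy d) {n k : ℕ}
    (hk : n ≤ k) (x : ℝ) (a : ℝ≥0∞) :
    consumptionMoment M W P γ ν n x k + a * wealthMoment M W P γ ν n x (k + 1) =
      ∫⁻ ω, (ENNReal.ofReal (ν.η k (wealth M W ν n x k ω) ^ (1 - γ)) + a *
        ∫⁻ ω', ENNReal.ofReal ((Real.exp (M.r * M.Δ) *
          (wealth M W ν n x k ω - ν.η k (wealth M W ν n x k ω)
            + ∑ i, ν.φ k (wealth M W ν n x k ω) i * M.ret W k i ω')) ^ (1 - γ)) ∂P) ∂P := by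
  let G : ℝ × (Fin d → ℝ) → ℝ≥0∞ := fun p => ENNReal.ofReal
    ((Real.exp (M.r * M.Δ) * (p.1 - ν.η k p.1 + ∑ i, ν.φ k p.1 i * p.2 i)) ^ (1 - γ))
  have hG : Measurable G := by
    have h1 : Measurable fun p : ℝ × (Fin d → ℝ) => ν.η k p.1 :=
      (ν.η_measurable k).comp measurable_fst
    have h2 : Measurable fun p : ℝ × (Fin d → ℝ) => ∑ i, ν.φ k p.1 i * p.2 i :=
      Finset.measurable_fun_sum _ fun i _ =>
        ((measurable_pi_apply i).comp ((ν.φ_measurable k).comp measurable_fst)).mul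
          ((measurable_pi_apply i).comp measurable_snd)
    exact ((((measurable_fst.sub h1).add h2).const_mul _).pow_const _).ennreal_ofReal
  have hnext : wealthMoment M W P γ ν n x (k + 1) =
      ∫⁻ ω, G (wealth M W ν n x k ω, fun i => M.ret W k i ω) ∂P := by
    simp only [wealthMoment, wealth_succ M W ν x hk, G]
  have hinner : Measurable fun ω =>
      ∫⁻ ω', G (wealth M W ν n x k ω, fun i => M.ret W k i ω') ∂P := by
    refine Measurable.lintegral_prod_right' (f := fun p : Ω × Ω =>
      G (wealth M W ν n x k p.1, fun i => M.ret W k i p.2)) (hG.comp ?_)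
    exact ((hW.measurable_wealth M ν n x k).comp measurable_fst).prodMk
      (measurable_pi_lambda _ fun i => (hW.measurable_ret M k i).comp measurable_snd)
  rw [hnext, hW.lintegral_wealth_ret M ν n x k hG, consumptionMoment,
    ← lintegral_const_mul _ hinner,
    ← lintegral_add_left ((hW.measurable_consumption ν n x k).pow_const _).ennreal_ofReal]

lemma IsBrownianVec.consumptionMoment_add_le (hW : IsBrownianVec W P) (hγ0 : 0 < γ) (hγ1 : γ < 1)
    (ν : Strategy d) {n k : ℕ} (hk : n ≤ k) (x : ℝ) {c' b : ℝ} (hc' : 0 ≤ c') (hb : 0 ≤ b)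
    (h : ∀ᵐ ω ∂P, 0 < wealth M W ν n x k ω ∧
      ∃ ζ ∈ Set.Icc (0 : ℝ) 1, ∃ β ∈ simplex d,
        ν.φ k (wealth M W ν n x k ω) = ((1 - ζ) * wealth M W ν n x k ω) • β ∧
        ν.η k (wealth M W ν n x k ω) = ζ * wealth M W ν n x k ω ∧
        periodValue M W P γ k c' ζ β ≤ b) :
    consumptionMoment M W P γ ν n x k + ENNReal.ofReal c' * wealthMoment M W P γ ν n x (k + 1) ≤
      ENNReal.ofReal b * wealthMoment M W P γ ν n x k := by
  rw [hW.consumptionMoment_add ν hk, hW.ofReal_mul_wealthMoment hb]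
  refine lintegral_mono_ae (h.mono ?_)
  rintro ω ⟨hpos, ζ, hζ, β, hβ, hφ, hη, hle⟩
  rw [hφ, hη, hW.utility_add_next_eq hγ0 hγ1 k hc' hpos.le hζ hβ]
  gcongr

lemma IsBrownianVec.le_consumptionMoment_add (hW : IsBrownianVec W P) (hγ0 : 0 < γ) (hγ1 : γ < 1)
    (ν : Strategy d) {n k : ℕ} (hk : n ≤ k) (x : ℝ) {c' b : ℝ} (hc' : 0 ≤ c') (hb : 0 ≤ b)
    (h : ∀ᵐ ω ∂P, 0 < wealth M W ν n x k ω ∧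
      ∃ ζ ∈ Set.Icc (0 : ℝ) 1, ∃ β ∈ simplex d,
        ν.φ k (wealth M W ν n x k ω) = ((1 - ζ) * wealth M W ν n x k ω) • β ∧
        ν.η k (wealth M W ν n x k ω) = ζ * wealth M W ν n x k ω ∧
        b ≤ periodValue M W P γ k c' ζ β) :
    ENNReal.ofReal b * wealthMoment M W P γ ν n x k ≤
      consumptionMoment M W P γ ν n x k +
        ENNReal.ofReal c' * wealthMoment M W P γ ν n x (k + 1) := by
  rw [hW.consumptionMoment_add ν hk, hW.ofReal_mul_wealthMoment hb]
  refine lintegral_mono_ae (h.mono ?_)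
  rintro ω ⟨hpos, ζ, hζ, β, hβ, hφ, hη, hle⟩
  rw [hφ, hη, hW.utility_add_next_eq hγ0 hγ1 k hc' hpos.le hζ hβ]
  gcongr

end Dynamic

/-! ### Construction of nearly optimal strategies -/

section Construction

variable {d : ℕ}

lemma measurableSet_simplex : MeasurableSet (simplex d) := by
  have h1 : MeasurableSet {p : Fin d → ℝ | ∀ i, 0 ≤ p i ∧ p i ≤ 1} := by
    simp only [Set.ofPred_forall, Set.ofPred_and]
    exact .iInter fun i => (measurableSet_le measurable_const (measurable_pi_apply i)).inter
      (measurableSet_le (measurable_pi_apply i) measurable_const)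
  exact h1.inter (measurableSet_le
    (Finset.measurable_fun_sum _ fun i _ => measurable_pi_apply i) measurable_const)

lemma measurableSet_feasible (C : RiskConstraint d) (k : ℕ) :
    MeasurableSet {p : ℝ × (Fin d → ℝ) × ℝ | p.2.1 ∈ feasible C k p.1 p.2.2} := by
  have hψ : Measurable fun p : ℝ × (Fin d → ℝ) × ℝ => C.ψrel k p.1 p.2.1 p.2.2 := by
    have hpos : Measurable fun p : ℝ × (Fin d → ℝ) × ℝ =>
        (p.1, ((1 - p.2.2) * p.1) • p.2.1, p.2.2 * p.1) := by fun_prop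
    exact (C.ψ_measurable k).comp hpos
  exact (measurableSet_simplex.preimage (measurable_fst.comp measurable_snd)).inter
    (measurableSet_le hψ ((C.ε_measurable k).comp measurable_fst))

open Classical in
/-- The strategy `ν`, except that at time `t_k` the proportion `(f x).2` of the wealth `x` is
consumed and the rest is invested according to the proportions `(f x).1`. Negative amounts are
replaced by `0`, so that this is a strategy for every measurable `f`. -/
noncomputable def Strategy.update (ν : Strategy d) (k : ℕ) (f : ℝ → (Fin d → ℝ) × ℝ)
    (hf : Measurable f) : Strategy d where
  φ := Function.update ν.φ k fun x i => max 0 (((1 - (f x).2) * x) • (f x).1) i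
  η := Function.update ν.η k fun x => max 0 ((f x).2 * x)
  φ_measurable l := by
    rcases eq_or_ne l k with rfl | hl
    · simp only [Function.update_self]
      refine measurable_pi_lambda _ fun i => ?_
      simp only [Pi.sup_apply, Pi.zero_apply, Pi.smul_apply, smul_eq_mul]
      fun_prop
    · simpa only [Function.update_of_ne hl] using ν.φ_measurable l
  η_measurable l := by
    rcases eq_or_ne l k with rfl | hl
    · simp only [Function.update_self]
      fun_prop
    · simpa only [Function.update_of_ne hl] using ν.η_measurable l
  φ_nonneg l x i := by
    rcases eq_or_ne l k with rfl | hl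
    · simp
    · simpa only [Function.update_of_ne hl] using ν.φ_nonneg l x i
  η_nonneg l x := by
    rcases eq_or_ne l k with rfl | hl
    · simp
    · simpa only [Function.update_of_ne hl] using ν.η_nonneg l x

/-- The strategy that neither invests nor consumes. -/
def Strategy.idle : Strategy d where
  φ _ _ _ := 0
  η _ _ := 0
  φ_measurable _ := measurable_const
  η_measurable _ := measurable_const
  φ_nonneg _ _ _ := le_rfl
  η_nonneg _ _ := le_rfl

variable {Ω : Type*} {m : ℕ} [MeasurableSpace Ω] {P : Measure Ω}
  {M : Market d m} {W : Fin m → ℝ≥0 → Ω → ℝ} {C : RiskConstraint d} {γ : ℝ}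

/-- At time `t_k`, wealth `X_k` is positive and the position of `ν` is given by permitted
proportions `(ζ, β)` whose value in the recursion with coefficient `c'` is at least `b`. Before the
last period not all wealth is consumed. -/
def AttainsAt (M : Market d m) (W : Fin m → ℝ≥0 → Ω → ℝ) (P : Measure Ω) (C : RiskConstraint d)
    (γ : ℝ) (ν : Strategy d) (n : ℕ) (x : ℝ) (k : ℕ) (c' b : ℝ) (ω : Ω) : Prop :=
  0 < wealth M W ν n x k ω ∧
    ∃ ζ ∈ Set.Icc (0 : ℝ) 1, ∃ β ∈ feasible C k (wealth M W ν n x k ω) ζ,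
      ν.φ k (wealth M W ν n x k ω) = ((1 - ζ) * wealth M W ν n x k ω) • β ∧
      ν.η k (wealth M W ν n x k ω) = ζ * wealth M W ν n x k ω ∧
      (k + 1 < M.N → ζ < 1) ∧ b ≤ periodValue M W P γ k c' ζ β

lemma AttainsAt.position_mem {ν : Strategy d} {n k : ℕ} {x c' b : ℝ} {ω : Ω}
    (h : AttainsAt M W P C γ ν n x k c' b ω) :
    position M W ν n x k ω ∈ riskPositions C k (wealth M W ν n x k ω) := by
  obtain ⟨hpos, ζ, hζ, β, hβ, hφ, hη, -⟩ := h
  rw [position, hφ, hη]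
  exact mem_riskPositions hpos.le hζ hβ

variable [IsProbabilityMeasure P]

/-- Nearly optimal proportions can be pasted to a strategy, one period after the other: at time
`t_k` they are selected measurably up to a null set of the law of `X_k`, which only depends on what
was selected before. -/
lemma IsBrownianVec.exists_strategy (hW : IsBrownianVec W P) {c' b : ℕ → ℝ}
    (h : ∀ k < M.N, ∀ x : ℝ, 0 < x → ∃ ζ ∈ Set.Icc (0 : ℝ) 1, ∃ β ∈ feasible C k x ζ,
      (k + 1 < M.N → ζ < 1) ∧ b k ≤ periodValue M W P γ k (c' k) ζ β)
    {n k : ℕ} (hnk : n ≤ k) (hk : k ≤ M.N) {x : ℝ} (hx : 0 < x) :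
    ∃ ν : Strategy d, ∀ l, n ≤ l → l < k →
      ∀ᵐ ω ∂P, AttainsAt M W P C γ ν n x l (c' l) (b l) ω := by
  induction k, hnk using Nat.le_induction with
  | base => exact ⟨.idle, fun l h1 h2 => by lia⟩
  | succ k hnk ih =>
    obtain ⟨ν, hν⟩ := ih (by lia)
    have hpos : ∀ᵐ ω ∂P, 0 < wealth M W ν n x k ω := by
      rcases hnk.lt_or_eq with hlt | rfl
      · obtain ⟨l, rfl⟩ : ∃ l, k = l + 1 := ⟨k - 1, by lia⟩
        refine (hν l (by lia) (by lia)).mono ?_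
        rintro ω ⟨hX, ζ, -, β, hβ, hφ, hη, hζ1, -⟩
        exact wealth_succ_pos M W ν (by lia) x hX (hζ1 (by lia)) hβ.1 hφ hη
      · exact ae_of_all _ fun ω => (wealth_of_le M W ν x le_rfl ω).symm ▸ hx
    have hX := hW.measurable_wealth M ν n x k
    let A : Set (ℝ × (Fin d → ℝ) × ℝ) := {p | p.2.1 ∈ feasible C k p.1 p.2.2} ∩
      {p | p.2.2 ∈ Set.Icc (0 : ℝ) 1 ∩ {ζ | k + 1 < M.N → ζ < 1}} ∩
      {p | b k ≤ periodValue M W P γ k (c' k) p.2.2 p.2.1}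
    have hA : MeasurableSet A := by
      refine ((measurableSet_feasible C k).inter ?_).inter ?_
      · refine MeasurableSet.preimage (measurableSet_Icc.inter ?_)
          (measurable_snd.comp measurable_snd)
        by_cases hp : k + 1 < M.N
        · have : {ζ : ℝ | k + 1 < M.N → ζ < 1} = Set.Iio 1 := by ext; simp [hp]
          exact this ▸ measurableSet_Iio
        · simp [hp]
      · refine measurableSet_le measurable_const ?_
        have hrm : Measurable fun p : ℝ × (Fin d → ℝ) × ℝ => returnMoment M W P γ k p.2.1 :=
          (hW.measurable_returnMoment M γ k).comp (measurable_fst.comp measurable_snd)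
        have hζ : Measurable fun p : ℝ × (Fin d → ℝ) × ℝ => p.2.2 :=
          measurable_snd.comp measurable_snd
        exact (hζ.pow_const _).add
          (((((hζ.const_sub 1).pow_const _).mul_const _).mul hrm).mul_const _)
    have hprob : IsProbabilityMeasure (P.map (wealth M W ν n x k)) :=
      Measure.isProbabilityMeasure_map hX.aemeasurable
    obtain ⟨f, hf, hfA⟩ := exists_measurable_selection (P.map (wealth M W ν n x k)) hA (by
      have : ∀ᵐ y ∂P.map (wealth M W ν n x k), 0 < y :=
        (ae_map_iff hX.aemeasurable measurableSet_Ioi).2 hpos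
      refine this.mono fun y hy => ?_
      obtain ⟨ζ, hζ, β, hβ, hζ1, hval⟩ := h k (by lia) y hy
      exact ⟨(β, ζ), ⟨⟨hβ, hζ, hζ1⟩, hval⟩⟩)
    have hfA' := ae_of_ae_map hX.aemeasurable hfA
    let ν' := ν.update k f hf
    have hφ' (l : ℕ) (hl : l ≠ k) : ν'.φ l = ν.φ l := Function.update_of_ne hl _ _
    have hη' (l : ℕ) (hl : l ≠ k) : ν'.η l = ν.η l := Function.update_of_ne hl _ _
    have hw (l : ℕ) (hl : l ≤ k) (ω : Ω) : wealth M W ν' n x l ω = wealth M W ν n x l ω :=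
      wealth_congr M W n x (fun i hi => hφ' i (by lia)) (fun i hi => hη' i (by lia)) ω
    refine ⟨ν', fun l hnl hlk => ?_⟩
    rcases (Nat.lt_succ_iff.1 hlk).lt_or_eq with hlt | rfl
    · simpa only [AttainsAt, hw l hlt.le, hφ' l hlt.ne, hη' l hlt.ne] using hν l hnl hlt
    · filter_upwards [hpos, hfA'] with ω hω hfω
      obtain ⟨⟨hβ, hζ, hζ1⟩, hval⟩ := hfω
      rw [AttainsAt, hw l le_rfl]
      refine ⟨hω, _, hζ, _, hβ, ?_, ?_, hζ1, hval⟩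
      · have h1 : ν'.φ l = fun x i => max 0 (((1 - (f x).2) * x) • (f x).1) i :=
          Function.update_self _ _ _
        rw [h1]
        ext i
        refine max_eq_right (mul_nonneg (mul_nonneg ?_ hω.le) (hβ.1.1 i).1)
        linarith [hζ.2]
      · have h1 : ν'.η l = fun x => max 0 ((f x).2 * x) := Function.update_self _ _ _
        rw [h1]
        exact max_eq_right (mul_nonneg hζ.1 hω.le)

end Construction

/-! ### Verification -/

section Verification

variable {Ω : Type*} {d m : ℕ} [MeasurableSpace Ω] {P : Measure Ω} [IsProbabilityMeasure P]
  {M : Market d m} {W : Fin m → ℝ≥0 → Ω → ℝ} {C : RiskConstraint d} {γ : ℝ}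

/-- Along any admissible strategy `E[∑_{l<k} η_l^{1-γ} + c_k X_k^{1-γ}]` is nonincreasing in `k`. -/
lemma IsBrownianVec.expectedUtility_le (hW : IsBrownianVec W P) (hγ0 : 0 < γ) (hγ1 : γ < 1)
    {c : ℕ → ℝ} (hc : SolvesRecursion M W P C γ c) {n : ℕ} (hn : n ≤ M.N) {x : ℝ} (hx : 0 < x)
    {ν : Strategy d} (hν : ν ∈ riskAdmissible M W P C n x) :
    expectedUtility M W P γ n x ν ≤ ENNReal.ofReal (x ^ (1 - γ) / (1 - γ) * c n) := by
  have hγ : 0 ≤ (1 - γ)⁻¹ := inv_nonneg.2 (by linarith)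
  have hpos {k : ℕ} (hk : k ≤ M.N) : 0 ≤ c k := (hW.pos_of_solvesRecursion hγ0 hγ1 hc hk).le
  have htel {k : ℕ} (hnk : n ≤ k) (hk : k ≤ M.N) :
      ∑ l ∈ Finset.Ico n k, consumptionMoment M W P γ ν n x l +
        ENNReal.ofReal (c k) * wealthMoment M W P γ ν n x k ≤
      ENNReal.ofReal (c n) * ENNReal.ofReal (x ^ (1 - γ)) := by
    induction k, hnk using Nat.le_induction with
    | base => simp [wealthMoment_self]
    | succ k hnk ih =>
      refine le_trans ?_ (ih (by lia))
      rw [Finset.sum_Ico_succ_top hnk, add_assoc]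
      gcongr
      refine hW.consumptionMoment_add_le hγ0 hγ1 ν hnk x (hpos hk) (hpos (by lia)) ?_
      filter_upwards [hν.1.1 k hnk hk, hν.2 k hnk hk] with ω h1 h2
      obtain ⟨ζ, hζ, β, hβ, hφ, hη⟩ := exists_proportions h1.1 (ν.φ_nonneg _ _) h2
      exact ⟨h1.1, ζ, hζ, β, hβ.1, hφ, hη,
        hW.periodValue_le hγ0 hγ1 (hpos hk) (hc.2 k hk _ h1.1) hζ hβ⟩
  have h := htel hn le_rfl
  rw [hc.1, ENNReal.ofReal_one, one_mul] at h
  rw [hW.expectedUtility_eq hγ1 ν n x (wealth_terminal_nonneg hn hx hν.1.1)]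
  calc _ ≤ ENNReal.ofReal (1 - γ)⁻¹ * (ENNReal.ofReal (c n) * ENNReal.ofReal (x ^ (1 - γ))) := by
        gcongr
    _ = _ := by
        rw [← ENNReal.ofReal_mul (hpos hn), ← ENNReal.ofReal_mul hγ]
        ring_nf

/-- A strategy which attains the fraction `θ` of the coefficient `c_k` in every period attains the
fraction `θ^{N-n}` of the claimed value. -/
lemma IsBrownianVec.exists_le_expectedUtility (hW : IsBrownianVec W P) (hγ0 : 0 < γ) (hγ1 : γ < 1)
    {c : ℕ → ℝ} (hc : SolvesRecursion M W P C γ c)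
    (hloss : ∀ n ≤ M.N, ∀ x : ℝ, 0 < x → ∀ ν ∈ admissible M W P n x,
      RespectsRisk M W P C n x ν → ν ∈ lossAdmissible M W P C n x)
    (hfull : ∀ n, n + 1 < M.N → ∀ x : ℝ, 0 < x → (feasible C n x 1).Nonempty →
      (1 : ℝ) ∈ closure {ζ : ℝ | ζ ∈ Set.Ico (0 : ℝ) 1 ∧ (feasible C n x ζ).Nonempty})
    {n : ℕ} (hn : n ≤ M.N) {x : ℝ} (hx : 0 < x) {θ : ℝ} (hθ0 : 0 ≤ θ) (hθ1 : θ < 1) :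
    ∃ ν ∈ riskAdmissible M W P C n x,
      ENNReal.ofReal (x ^ (1 - γ) / (1 - γ) * (θ ^ (M.N - n) * c n)) ≤
        expectedUtility M W P γ n x ν := by
  have hγ : 0 ≤ (1 - γ)⁻¹ := inv_nonneg.2 (by linarith)
  have hpos {k : ℕ} (hk : k ≤ M.N) : 0 < c k := hW.pos_of_solvesRecursion hγ0 hγ1 hc hk
  obtain ⟨ν, hν⟩ := hW.exists_strategy (M := M) (C := C) (γ := γ) (c' := fun k => c (k + 1))
    (b := fun k => θ * c k) (fun k hk y hy =>
      hW.exists_periodValue_gt hγ0 hγ1 (hpos hk) (hc.2 k hk y hy)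
        (by nlinarith [hpos hk.le]) fun hk' => hfull k hk' y hy) hn le_rfl hx
  have hrisk : RespectsRisk M W P C n x ν := fun k hnk hk =>
    (hν k hnk hk).mono fun ω h => h.position_mem
  have hadm : ν ∈ admissible M W P n x := fun k hnk hk =>
    (hν k hnk hk).mono fun ω h => ⟨h.1, h.position_mem.1⟩
  refine ⟨ν, ⟨hloss n hn x hx ν hadm hrisk, hrisk⟩, ?_⟩
  have hθ : ENNReal.ofReal θ ≤ 1 := ENNReal.ofReal_le_one.2 hθ1.le
  have htel {k : ℕ} (hnk : n ≤ k) (hk : k ≤ M.N) :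
      ENNReal.ofReal θ ^ (k - n) * (ENNReal.ofReal (c n) * ENNReal.ofReal (x ^ (1 - γ))) ≤
      ∑ l ∈ Finset.Ico n k, consumptionMoment M W P γ ν n x l +
        ENNReal.ofReal (c k) * wealthMoment M W P γ ν n x k := by
    induction k, hnk using Nat.le_induction with
    | base => simp [wealthMoment_self]
    | succ k hnk ih =>
      have hstep := hW.le_consumptionMoment_add hγ0 hγ1 ν hnk x (hpos hk).le
        (mul_nonneg hθ0 (hpos (k := k) (by lia)).le) ((hν k hnk hk).mono (by
          rintro ω ⟨h1, ζ, hζ, β, hβ, hφ, hη, -, hval⟩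
          exact ⟨h1, ζ, hζ, β, hβ.1, hφ, hη, hval⟩))
      rw [Nat.succ_sub hnk, pow_succ', mul_assoc, Finset.sum_Ico_succ_top hnk, add_assoc]
      calc _ ≤ ENNReal.ofReal θ * (∑ l ∈ Finset.Ico n k, consumptionMoment M W P γ ν n x l +
              ENNReal.ofReal (c k) * wealthMoment M W P γ ν n x k) := by
            gcongr
            exact ih (by lia)
        _ = ENNReal.ofReal θ * ∑ l ∈ Finset.Ico n k, consumptionMoment M W P γ ν n x l +
              ENNReal.ofReal (θ * c k) * wealthMoment M W P γ ν n x k := by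
            rw [mul_add, ENNReal.ofReal_mul hθ0, mul_assoc]
        _ ≤ _ := add_le_add (mul_le_of_le_one_left' hθ) hstep
  have h := htel hn le_rfl
  rw [hc.1, ENNReal.ofReal_one, one_mul] at h
  rw [hW.expectedUtility_eq hγ1 ν n x (wealth_terminal_nonneg hn hx hadm)]
  calc _ = ENNReal.ofReal (1 - γ)⁻¹ * (ENNReal.ofReal θ ^ (M.N - n) *
        (ENNReal.ofReal (c n) * ENNReal.ofReal (x ^ (1 - γ)))) := by
        rw [← ENNReal.ofReal_mul (hpos hn).le, ← ENNReal.ofReal_pow hθ0,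
          ← ENNReal.ofReal_mul (by positivity), ← ENNReal.ofReal_mul hγ]
        ring_nf
    _ ≤ _ := by gcongr

lemma IsBrownianVec.valueFunction_eq (hW : IsBrownianVec W P) (hγ0 : 0 < γ) (hγ1 : γ < 1)
    {c : ℕ → ℝ} (hc : SolvesRecursion M W P C γ c)
    (hloss : ∀ n ≤ M.N, ∀ x : ℝ, 0 < x → ∀ ν ∈ admissible M W P n x,
      RespectsRisk M W P C n x ν → ν ∈ lossAdmissible M W P C n x)
    (hfull : ∀ n, n + 1 < M.N → ∀ x : ℝ, 0 < x → (feasible C n x 1).Nonempty →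
      (1 : ℝ) ∈ closure {ζ : ℝ | ζ ∈ Set.Ico (0 : ℝ) 1 ∧ (feasible C n x ζ).Nonempty})
    {n : ℕ} (hn : n ≤ M.N) {x : ℝ} (hx : 0 < x) :
    valueFunction M W P C γ n x = ((x ^ (1 - γ) / (1 - γ) * c n : ℝ) : EReal) := by
  have hγ : 0 < 1 - γ := by linarith
  have hcn := hW.pos_of_solvesRecursion hγ0 hγ1 hc hn
  have hcoe {r : ℝ} (hr : 0 ≤ r) : ((ENNReal.ofReal r : ℝ≥0∞) : EReal) = (r : EReal) := by
    rw [EReal.coe_ennreal_ofReal, max_eq_left hr]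
  apply le_antisymm
  · refine iSup₂_le fun ν hν => ?_
    rw [← hcoe (by positivity)]
    exact EReal.coe_ennreal_le_coe_ennreal_iff.2 (hW.expectedUtility_le hγ0 hγ1 hc hn hx hν)
  · have hlim : Filter.Tendsto (fun θ : ℝ =>
        ((x ^ (1 - γ) / (1 - γ) * (θ ^ (M.N - n) * c n) : ℝ) : EReal)) (nhdsWithin 1 (Set.Iio 1))
        (nhds ((x ^ (1 - γ) / (1 - γ) * c n : ℝ) : EReal)) := by
      have hcont : Continuous fun θ : ℝ =>
          ((x ^ (1 - γ) / (1 - γ) * (θ ^ (M.N - n) * c n) : ℝ) : EReal) :=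
        continuous_coe_real_ereal.comp (by fun_prop)
      simpa using (hcont.tendsto 1).mono_left nhdsWithin_le_nhds
    refine le_of_tendsto hlim ?_
    filter_upwards [Ioo_mem_nhdsLT (zero_lt_one (α := ℝ))] with θ hθ
    obtain ⟨ν, hν, hle⟩ := hW.exists_le_expectedUtility hγ0 hγ1 hc hloss hfull hn hx hθ.1.le hθ.2
    have hθ0 := hθ.1
    rw [← hcoe (by positivity)]
    exact (EReal.coe_ennreal_le_coe_ennreal_iff.2 hle).trans
      (le_iSup₂ (f := fun ν (_ : ν ∈ riskAdmissible M W P C n x) =>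
        ((expectedUtility M W P γ n x ν : ℝ≥0∞) : EReal)) ν hν)

end Verification

/-! ### Solving the recursion -/

section Recursion

variable {Ω : Type*} {d m : ℕ} [MeasurableSpace Ω] {P : Measure Ω}
  {M : Market d m} {W : Fin m → ℝ≥0 → Ω → ℝ} {C : RiskConstraint d} {γ : ℝ}

lemma recursionRHS_congr {k : ℕ} {x y : ℝ} (c' : ℝ)
    (h : ∀ ζ ∈ Set.Icc (0 : ℝ) 1, feasible C k x ζ = feasible C k y ζ) :
    recursionRHS M W P C γ k x c' = recursionRHS M W P C γ k y c' := by
  have hset : {ζ : ℝ | ζ ∈ Set.Icc (0 : ℝ) 1 ∧ (feasible C k x ζ).Nonempty} =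
      {ζ : ℝ | ζ ∈ Set.Icc (0 : ℝ) 1 ∧ (feasible C k y ζ).Nonempty} :=
    Set.ext fun ζ => and_congr_right fun hζ => by rw [h ζ hζ]
  rw [recursionRHS, recursionRHS, hset]
  exact iSup_congr fun ζ => iSup_congr fun hζ => by rw [h ζ hζ.1]

lemma exists_feasible_of_riskAdmissible [IsProbabilityMeasure P] {n k : ℕ}
    (hnk : n ≤ k) (hk : k < M.N) {x : ℝ} {ν : Strategy d} (hν : ν ∈ riskAdmissible M W P C n x) :
    ∃ y : ℝ, 0 < y ∧ ∃ ζ ∈ Set.Icc (0 : ℝ) 1, (feasible C k y ζ).Nonempty := by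
  obtain ⟨ω, h1, h2⟩ := ((hν.1.1 k hnk hk).and (hν.2 k hnk hk)).exists
  obtain ⟨ζ, hζ, β, hβ, -⟩ := exists_proportions h1.1 (ν.φ_nonneg _ _) h2
  exact ⟨_, h1.1, ζ, hζ, β, hβ⟩

/-- The solution of the backward recursion at wealth `1`, `j` periods before the end. -/
noncomputable def backwardCoeff (M : Market d m) (W : Fin m → ℝ≥0 → Ω → ℝ) (P : Measure Ω)
    (C : RiskConstraint d) (γ : ℝ) : ℕ → ℝ
  | 0 => 1
  | j + 1 => (recursionRHS M W P C γ (M.N - (j + 1)) 1 (backwardCoeff M W P C γ j)).toReal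

lemma IsBrownianVec.exists_solvesRecursion [IsProbabilityMeasure P]
    (hW : IsBrownianVec W P) (hγ0 : 0 < γ) (hγ1 : γ < 1)
    {x₀ : ℝ} (hne : (riskAdmissible M W P C 0 x₀).Nonempty)
    (hinv : ∀ n < M.N, ∀ x y : ℝ, 0 < x → 0 < y → ∀ ζ ∈ Set.Icc (0 : ℝ) 1,
        feasible C n x ζ = feasible C n y ζ) :
    ∃ c : ℕ → ℝ, SolvesRecursion M W P C γ c := by
  let g := backwardCoeff M W P C γ
  have hstep (j : ℕ) (hj : j < M.N) (hg : 0 < g j) :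
      ((g (j + 1) : ℝ) : EReal) = recursionRHS M W P C γ (M.N - (j + 1)) 1 (g j) := by
    refine EReal.coe_toReal (hW.recursionRHS_ne_top hγ0 hγ1 _ _ hg.le) ?_
    obtain ⟨ν, hν⟩ := hne
    obtain ⟨y, hy, ζ, hζ, hf⟩ := exists_feasible_of_riskAdmissible (k := M.N - (j + 1))
      (Nat.zero_le _) (by lia) hν
    rw [hinv _ (by lia) y 1 hy one_pos ζ hζ] at hf
    -- some wealth level is visited by an admissible strategy, and all wealth levels are alike
    refine ne_bot_of_le_ne_bot ?_ (le_iSup₂ (α := EReal) ζ ⟨hζ, hf⟩)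
    exact EReal.coe_ne_bot _
  have hpos (j : ℕ) (hj : j ≤ M.N) : 0 < g j := by
    induction j with
    | zero => exact one_pos
    | succ j ih => exact hW.pos_of_coe_eq hγ0 hγ1 (ih (by lia)) (hstep j hj (ih (by lia)))
  refine ⟨fun k => g (M.N - k), by simp [g, backwardCoeff], fun k hk x hx => ?_⟩
  obtain ⟨j, hj⟩ : ∃ j, M.N = k + (j + 1) := ⟨M.N - (k + 1), by lia⟩
  have h1 : M.N - k = j + 1 := by lia
  have h2 : M.N - (k + 1) = j := by lia
  have h3 : M.N - (j + 1) = k := by lia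
  have h := hstep j (by lia) (hpos j (by lia))
  rw [h3] at h
  simp only [h1, h2]
  rw [h]
  exact recursionRHS_congr _ (hinv k hk 1 x one_pos hx)

end Recursion

end PowerDP

theorem theorem1 {Ω : Type*} [MeasurableSpace Ω] (P : Measure Ω) [IsProbabilityMeasure P]
    {d m : ℕ} (M : PowerDP.Market d m) (W : Fin m → ℝ≥0 → Ω → ℝ)
    (hW : PowerDP.IsBrownianVec W P)
    (C : PowerDP.RiskConstraint d) (γ : ℝ) (hγ0 : 0 < γ) (hγ1 : γ < 1)
    -- there is an admissible strategy for some positive initial wealth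
    (x₀ : ℝ) (hx₀ : 0 < x₀) (hne : (PowerDP.riskAdmissible M W P C 0 x₀).Nonempty)
    -- the benchmark is such that losses under the risk constraint are integrable
    (hloss : ∀ n ≤ M.N, ∀ x : ℝ, 0 < x → ∀ ν ∈ PowerDP.admissible M W P n x,
      PowerDP.RespectsRisk M W P C n x ν → ν ∈ PowerDP.lossAdmissible M W P C n x)
    -- before the last period, full consumption is permitted only as a limit of partial consumption
    (hfull : ∀ n, n + 1 < M.N → ∀ x : ℝ, 0 < x → (PowerDP.feasible C n x 1).Nonempty →
      (1 : ℝ) ∈ closure {ζ : ℝ | ζ ∈ Set.Ico (0 : ℝ) 1 ∧ (PowerDP.feasible C n x ζ).Nonempty}) :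
    (∀ c : ℕ → ℝ, PowerDP.SolvesRecursion M W P C γ c →
      ∀ n ≤ M.N, ∀ x : ℝ, 0 < x →
        PowerDP.valueFunction M W P C γ n x
          = ((x ^ (1 - γ) / (1 - γ) * c n : ℝ) : EReal)) ∧
    ((∀ n < M.N, ∀ x y : ℝ, 0 < x → 0 < y → ∀ ζ ∈ Set.Icc (0 : ℝ) 1,
        PowerDP.feasible C n x ζ = PowerDP.feasible C n y ζ) →
      ∃ c : ℕ → ℝ, PowerDP.SolvesRecursion M W P C γ c ∧
        ∀ n ≤ M.N, ∀ x : ℝ, 0 < x →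
          PowerDP.valueFunction M W P C γ n x
            = ((x ^ (1 - γ) / (1 - γ) * c n : ℝ) : EReal)) := by
  have key (c : ℕ → ℝ) (hc : PowerDP.SolvesRecursion M W P C γ c) (n : ℕ) (hn : n ≤ M.N) (x : ℝ)
      (hx : 0 < x) := hW.valueFunction_eq hγ0 hγ1 hc hloss hfull hn hx
  refine ⟨key, fun hinv => ?_⟩
  obtain ⟨c, hc⟩ := hW.exists_solvesRecursion hγ0 hγ1 hne hinv
  exact ⟨c, hc, key c hc⟩
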